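/- **Conventions.** Let $\Sigma$ be a (finite) ranked alphabet and let $T_\Sigma(Z)$ be the set of $\Sigma$-trees with leaves additionally labeled in $Z$; $T_\Sigma=T_\Sigma(\emptyset)$. For a tree $t$, positions are words over $\mathbb N$, $t|_w$ is the subtree at $w$, $t[s]_w$ is the substitution of $s$ at position $w$, and $\operatorname{ht}(t)$ is the maximal length of a position. Positions are ordered by the lexicographic order $\prec$ in which a proper prefix of $w$ is larger than $w$. A *weighted tree grammar with equality constraints* (WTGc) $(S,\Sigma,F,P,\mathrm{wt})$ consists of a finite set $S$ of states, final weights $F\colon S\to\mathbb N$, a finite set $P$ of productions $\ell\xrightarrow{E}q$ with $\ell\in T_\Sigma(S)\setminus S$, $q\in S$ and $E\subseteq\mathbb N^*\times\mathbb N^*$ finite, and weights $\mathrm{wt}\colon P\to\mathbb N$. A tree $s$ satisfies $E$ if for all $(v,v')\in E$ both $v,v'$ are positions of $s$ and $s|_v=s|_{v'}$. For $t\in T_\Sigma$, the set $D^q_G(t)$ consists of all sequences $d=(p_1,w_1)\cdots(p_n,w_n)$, $p_i=(\ell_i\xrightarrow{E_i}q_i)\in P$, with $w_1\prec\dots\prec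 w_n$, for which there are $\xi_0=t,\xi_1,\dots,\xi_n=q$ in $T_\Sigma(S)$ such that for each $i$: $\xi_{i-1}|_{w_i}=\ell_i$, $\xi_i=\xi_{i-1}[q_i]_{w_i}$, and $t|_{w_i}$ satisfies $E_i$. Put $\mathrm{wt}_G(d)=\prod_i\mathrm{wt}(p_i)$ and $[\![G]\!](t)=\sum_{q\in S,\,d\in D_G^q(t)}F(q)\,\mathrm{wt}_G(d)$. A *WTGh* is a WTGc $G=(Q\cup\{\bot\},\Sigma,F,P,\mathrm{wt})$ with a designated state $\bot\notin Q$ such that $F(\bot)=0$; for each $\gamma\in\Sigma$ the sink production $\gamma(\bot,\dots,\bot)\xrightarrow{\emptyset}\bot$ is in $P$ with weight $1$; no other productions in $P$ have target $\bot$; and for every production $\ell\xrightarrow{E}q$ in $P$, $E$ is an equivalence relation on some set of state-labeled positions of $\ell$ such that in each equivalence class the $\prec$-least position is labeled by a state different from $\bot$ and all other positions are labeled by $\bot$. It is *trim* if every production $p\in P$ other than the sink productions is used in some $d\in D_G^q(t)$ with $F(q)\cdot\mathrm{wt}_G(d)\neq0$, for some $t\in T_\Sigma$ and some state $q$. Its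 height is $\operatorname{ht}(G)=|Q|\cdot\max\{\operatorname{ht}(\ell)\mid(\ell\xrightarrow{E}q)\in P\}$ (with value $0$ if $P=\emptyset$). It has the *large duplication property* if there are a production $\ell\xrightarrow{E}q$ in $P$, a constraint $(u,v)\in E$ with $\ell(u)\ne\bot=\ell(v)$, and a tree $t\in T_\Sigma$ with $\operatorname{ht}(t)>\operatorname{ht}(G)$ and $D_G^{\ell(u)}(t)\neq\emptyset$. **Lemma.** Let $G=(Q\cup\{\bot\},\Sigma,F,P,\mathrm{wt})$ be a trim WTGh with the large duplication property. Then there exist two trim WTGh $G_1=(Q_1\cup\{\bot\},\Sigma,F_1,P_1,\mathrm{wt}_1)$ and $G_2=(Q_2\cup\{\bot\},\Sigma,F_2,P_2,\mathrm{wt}_2)$ such that $[\![G]\!](t)=[\![G_1]\!](t)+[\![G_2]\!](t)$ for all $t\in T_\Sigma$, and for some $f\in Q_1$: 1. $F_1(f)\neq0$ and $F_1(q)=0$ for all $q\in Q_1\setminus\{f\}$; 2. there is exactly one production $p_f=(\ell_f\xrightarrow{E_f}f)\in P_1$ with target $f$, and for this production there exist $(u,v)\in E_f$ with $\ell_f(u)\neq\ell_f(v)=\bot$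 and an infinite sequence $t_0,t_1,t_2,\dots\in T_\Sigma$ of pairwise distinct trees with $D_{G_1}^{\ell_f(u)}(t_i)\neq\emptyset$ for all $i\in\mathbb N$. -/

import Mathlib

universe u v

/-- `RTree rk Z` is the set `T_Σ(Z)` of trees over the ranked alphabet `(A, rk)` indexed by `Z`. -/
inductive RTree {A : Type u} (rk : A → ℕ) (Z : Type v) : Type (max u v)
  | var (z : Z) : RTree rk Z
  | node (a : A) (ts : Fin (rk a) → RTree rk Z) : RTree rk Z

namespace RTree

variable {A : Type u} {rk : A → ℕ} {Z : Type v}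

/-- The subtree `t|_w`, or `none` if `w` is not a position of `t`.  Positions are words over `ℕ`;
the children of a node of rank `k` are numbered `0, …, k - 1`. -/
def subtree? : RTree rk Z → List ℕ → Option (RTree rk Z)
  | t, [] => some t
  | var _, _ :: _ => none
  | node a ts, i :: w => if h : i < rk a then (ts ⟨i, h⟩).subtree? w else none

/-- The positions of a tree. -/
def pos (t : RTree rk Z) : Set (List ℕ) := {w | (t.subtree? w).isSome}

/-- The substitution `t[s]_w` (it is `t` if `w` is not a position of `t`). -/
def subst : RTree rk Z → List ℕ → RTree rk Z → RTree rk Z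
  | _, [], s => s
  | var z, _ :: _, _ => var z
  | node a ts, i :: w, s =>
      if h : i < rk a then node a (Function.update ts ⟨i, h⟩ ((ts ⟨i, h⟩).subst w s))
      else node a ts

/-- The height, i.e. the maximal length of a position. -/
def height : RTree rk Z → ℕ
  | var _ => 0
  | node _ ts => Finset.univ.sup fun i => (ts i).height + 1

/-- The inclusion of `T_Σ = T_Σ(∅)` into `T_Σ(Z)`. -/
def incl (Z : Type v) : RTree rk Empty → RTree rk Z
  | var z => z.elim
  | node a ts => node a fun i => (ts i).incl Z

theorem pos_finite (t : RTree rk Z) : t.pos.Finite := by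
  induction t with
  | var z =>
    refine (Set.finite_singleton ([] : List ℕ)).subset ?_
    rintro (_ | ⟨i, w⟩) h
    · simp
    · simp [pos, subtree?] at h
  | node a ts ih =>
    refine ((Set.finite_singleton ([] : List ℕ)).union
      (Set.finite_iUnion fun i : Fin (rk a) => (ih i).image (List.cons i.1))).subset ?_
    rintro (_ | ⟨i, w⟩) h
    · simp
    · by_cases hi : i < rk a
      · right
        simp only [pos, subtree?, hi, Set.mem_ofPred_eq, dite_true] at h
        exact Set.mem_iUnion.2 ⟨⟨i, hi⟩, w, h, rfl⟩
      · simp [pos, subtree?, hi] at h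

theorem pos_subst_var (z : Z) (t : RTree rk Z) (w : List ℕ) :
    (t.subst w (var z)).pos ⊆ t.pos := by
  induction w generalizing t with
  | nil =>
    rintro (_ | ⟨i, w⟩) h
    · simp [pos, subtree?]
    · simp [pos, subtree?, subst] at h
  | cons i w ih =>
    cases t with
    | var _ => simp [subst]
    | node a ts =>
      by_cases hi : i < rk a
      · rintro (_ | ⟨j, x⟩) h
        · simp [pos, subtree?]
        · by_cases hj : j < rk a
          · simp only [pos, subst, hi, subtree?, hj, Set.mem_ofPred_eq, dite_true] at h ⊢
            by_cases hij : (⟨j, hj⟩ : Fin (rk a)) = ⟨i, hi⟩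
            · rw [hij] at h ⊢
              rw [Function.update_self] at h
              exact ih _ h
            · rwa [Function.update_of_ne hij] at h
          · simp [pos, subst, hi, subtree?, hj] at h
      · simp [subst, hi]

end RTree

/-- The lexicographic order `v ≺ w` on positions in which prefixes are larger: either `w` is a
proper prefix of `v`, or `v` is smaller than `w` at the first index at which they differ. -/
def PosLT (v w : List ℕ) : Prop :=
  (∃ (i : ℕ) (x : List ℕ), v = w ++ i :: x) ∨
    ∃ (r : List ℕ) (i j : ℕ) (x y : List ℕ), v = r ++ i :: x ∧ w = r ++ j :: y ∧ i < j

theorem PosLT.ne {v w : List ℕ} (h : PosLT v w) : v ≠ w := by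
  rintro rfl
  rcases h with ⟨i, x, h⟩ | ⟨r, i, j, x, y, h, h', hij⟩
  · simpa using congrArg List.length h
  · have := List.append_cancel_left (h.symm.trans h')
    simp only [List.cons.injEq] at this
    omega

/-- The tree `t` satisfies all equality constraints in `E`. -/
def Satisfies {A : Type u} {rk : A → ℕ} {Z : Type v} (t : RTree rk Z)
    (E : Finset (List ℕ × List ℕ)) : Prop :=
  ∀ e ∈ E, ∃ s, t.subtree? e.1 = some s ∧ t.subtree? e.2 = some s

/-- Productions `(ℓ, q, E)` with `ℓ ∈ T_Σ(S) \ S`, `q ∈ S` and `E ⊆ ℕ* × ℕ*` finite. -/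
structure Production {A : Type u} (rk : A → ℕ) (S : Type v) where
  lhs : RTree rk S
  target : S
  constraints : Finset (List ℕ × List ℕ)
  lhs_ne_var : ∀ q : S, lhs ≠ RTree.var q

/-- Weighted tree grammars with equality constraints with state set `S`.  The weight function is
only relevant on the productions in `P`. -/
structure WTGc {A : Type u} (rk : A → ℕ) (S : Type v) where
  F : S → ℕ
  P : Finset (Production rk S)
  wt : Production rk S → ℕ

namespace WTGc

section Semantics

variable {A : Type u} {rk : A → ℕ} {S : Type v} (G : WTGc rk S)

/-- The derivation step from `ξ` to `ζ` for the input tree `t` by production `p` at position `w`. -/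
def Step (t : RTree rk Empty) (p : Production rk S) (w : List ℕ) (ξ ζ : RTree rk S) : Prop :=
  p ∈ G.P ∧ ξ.subtree? w = some p.lhs ∧ ζ = ξ.subst w (RTree.var p.target) ∧
    ∃ s, t.subtree? w = some s ∧ Satisfies s p.constraints

/-- `G.Derives t ξ d ζ`: the sequence `d` of steps for the input tree `t` leads from `ξ` to `ζ`. -/
inductive Derives (t : RTree rk Empty) :
    RTree rk S → List (Production rk S × List ℕ) → RTree rk S → Prop
  | nil (ξ : RTree rk S) : Derives t ξ [] ξ
  | cons {p : Production rk S} {w : List ℕ} {d : List (Production rk S × List ℕ)}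
      {ξ ζ η : RTree rk S} (h : G.Step t p w ξ ζ) (hd : Derives t ζ d η) :
      Derives t ξ ((p, w) :: d) η

/-- The set `D_G^q(t)` of complete left-most derivations for `t` to `q`. -/
def derivations (q : S) (t : RTree rk Empty) : Set (List (Production rk S × List ℕ)) :=
  {d | G.Derives t (t.incl S) d (RTree.var q) ∧ d.Pairwise fun x y => PosLT x.2 y.2}

/-- The weight of a derivation. -/
def derivWt (d : List (Production rk S × List ℕ)) : ℕ := (d.map fun x => G.wt x.1).prod

theorem Derives.mem {G : WTGc rk S} {t : RTree rk Empty} {ξ η : RTree rk S}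
    {d : List (Production rk S × List ℕ)} (h : G.Derives t ξ d η) :
    ∀ x ∈ d, x.1 ∈ G.P ∧ x.2 ∈ ξ.pos := by
  induction h with
  | nil => simp
  | cons h _ ih =>
    obtain ⟨hp, hw, rfl, -⟩ := h
    intro x hx
    rcases List.mem_cons.1 hx with rfl | hx
    · exact ⟨hp, by simp [RTree.pos, hw]⟩
    · exact ⟨(ih x hx).1, RTree.pos_subst_var _ _ _ (ih x hx).2⟩

/-- There are only finitely many derivations, so the sum in `sem` below is a genuine finite sum. -/
theorem derivations_finite (q : S) (t : RTree rk Empty) : (G.derivations q t).Finite := by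
  classical
  have hfin : ((G.P : Set (Production rk S)) ×ˢ (t.incl S).pos).Finite :=
    G.P.finite_toSet.prod (RTree.pos_finite _)
  have hperm : {l : List (Production rk S × List ℕ) |
      ∃ s ∈ hfin.toFinset.powerset, (l : Multiset _) = s.val}.Finite := by
    have : {l : List (Production rk S × List ℕ) |
        ∃ s ∈ hfin.toFinset.powerset, (l : Multiset _) = s.val} =
        ⋃ s ∈ hfin.toFinset.powerset,
          {l : List (Production rk S × List ℕ) | (l : Multiset _) = s.val} := by
      ext l
      simp
    rw [this]
    refine Set.Finite.biUnion (Finset.finite_toSet _) fun s _ => ?_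
    refine (List.finite_toSet s.toList.permutations).subset fun l hl => ?_
    have hl' : (l : Multiset (Production rk S × List ℕ)) =
        (s.toList : Multiset (Production rk S × List ℕ)) := by
      rw [Finset.coe_toList]; exact hl
    exact List.mem_permutations.2 (Multiset.coe_eq_coe.1 hl')
  refine hperm.subset fun d hd => ?_
  have hnd : d.Nodup := hd.2.imp fun h e => h.ne (by rw [e])
  refine ⟨⟨d, hnd⟩, ?_, rfl⟩
  rw [Finset.mem_powerset]
  intro x hx
  exact hfin.mem_toFinset.2 (hd.1.mem x hx)

/-- The weighted tree language `⟦G⟧` generated by `G`. -/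
noncomputable def sem [Fintype S] (t : RTree rk Empty) : ℕ :=
  ∑ q : S, ∑ᶠ d ∈ G.derivations q t, G.F q * G.derivWt d

/-- The production `p` is used in some accepting derivation of nonzero weight. -/
def Used (p : Production rk S) : Prop :=
  ∃ (t : RTree rk Empty) (q : S), ∃ d ∈ G.derivations q t,
    G.F q * G.derivWt d ≠ 0 ∧ ∃ w, (p, w) ∈ d

/-- The height of the set of productions. -/
def heightP : ℕ := G.P.sup fun p => p.lhs.height

end Semantics

section Sink

/- State sets `Q ∪ {⊥}` are written `Option Q`, with `none` for the sink state `⊥`. -/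

variable {A : Type u} {rk : A → ℕ} {Q : Type v}

/-- The production `γ(⊥, …, ⊥) → ⊥` without constraints. -/
def sinkProduction (Q : Type v) (a : A) : Production rk (Option Q) where
  lhs := RTree.node a fun _ => RTree.var none
  target := none
  constraints := ∅
  lhs_ne_var := fun _ h => by cases h

/-- `G`, with state set `Q ∪ {⊥}`, is a WTGh. -/
structure IsWTGh (G : WTGc rk (Option Q)) : Prop where
  F_sink : G.F none = 0
  sink_mem : ∀ a : A, sinkProduction Q a ∈ G.P
  wt_sink : ∀ a : A, G.wt (sinkProduction Q a) = 1
  eq_sink : ∀ p ∈ G.P, p.target = none → ∃ a : A, p = sinkProduction Q a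
  /-- Constraints point to state-labeled positions of the left-hand side. -/
  state_pos : ∀ p ∈ G.P, ∀ u v, (u, v) ∈ p.constraints →
    (∃ q, p.lhs.subtree? u = some (RTree.var q)) ∧ ∃ q, p.lhs.subtree? v = some (RTree.var q)
  /-- The constraints form an equivalence relation on the set of constrained positions. -/
  refl : ∀ p ∈ G.P, ∀ u v, (u, v) ∈ p.constraints → (u, u) ∈ p.constraints
  symm : ∀ p ∈ G.P, ∀ u v, (u, v) ∈ p.constraints → (v, u) ∈ p.constraints
  trans : ∀ p ∈ G.P, ∀ u v w, (u, v) ∈ p.constraints → (v, w) ∈ p.constraints →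
    (u, w) ∈ p.constraints
  /-- Among the constrained positions, exactly those that are not least in their equivalence class
  are labeled by the sink state. -/
  guarded : ∀ p ∈ G.P, ∀ w, (w, w) ∈ p.constraints →
    (p.lhs.subtree? w = some (RTree.var none) ↔ ∃ v, (v, w) ∈ p.constraints ∧ PosLT v w)

/-- Every production, apart from the obligatory ones targeting the sink state, is used in some
accepting derivation of nonzero weight. -/
def IsTrim (G : WTGc rk (Option Q)) : Prop :=
  ∀ p ∈ G.P, p.target ≠ none → G.Used p

/-- The height of `G`; the sink state is not counted. -/
def height [Fintype Q] (G : WTGc rk (Option Q)) : ℕ := Fintype.card Q * G.heightP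

/-- The large duplication property. -/
def LargeDuplication [Fintype Q] (G : WTGc rk (Option Q)) : Prop :=
  ∃ p ∈ G.P, ∃ u v, (u, v) ∈ p.constraints ∧ ∃ q : Option Q, q ≠ none ∧
    p.lhs.subtree? u = some (RTree.var q) ∧ p.lhs.subtree? v = some (RTree.var none) ∧
    ∃ t : RTree rk Empty, G.height < t.height ∧ (G.derivations q t).Nonempty

end Sink

end WTGc

-- A constraint class whose least position carries a state q and whose other positions carry ⊥ acts
-- like one variable of state q that occurs several times: the guard pays the weight, and ⊥ derives
-- every tree with total weight 1. A production is therefore a `HomRule`, a rule with a possibly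
-- nonlinear left-hand side ℓ. The derivation weights are the unique solution (`IsSolution.unique`)
-- of a recursion: the value at q of t is the sum, over the rules ℓ → q with ℓθ = t, of the rule
-- weight times the product over the variables x of ℓ of the value at the state of x of θ(x).
-- `WTGc.weight_eq_matchWt` carries the translation in both directions, and trimming preserves the
-- semantics.
--
-- By trimness, the production p with the large duplication occurs in an accepting derivation of
-- nonzero weight, to a state q₀ with F(q₀) ≠ 0. Unfold F(q₀) · value(q₀) along the path from the
-- root to p. A summand c · ℓ, with ℓ a term, is linear in the function attached to each variable,
-- since a variable contributes one factor however often it occurs. So if the rule j targets the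
-- state of x, the summand splits into one term with x replaced by the left-hand side of j and one
-- in which x is evaluated without j at its root (`exists_graft`). The latter is again given by
-- finitely many rules (`representable_valueWithout`) and goes into G₂, as do the final states other
-- than q₀. Once p has been grafted (`Occurs.split`), the term has a repeated variable of the
-- duplicated state; as the only rule of a fresh final state f it yields G₁ (`exists_root_grammar`).
--
-- For infinitely many trees at the duplicated state: if a state derives only finitely many trees,
-- then so do the states reached by following a highest tree downwards, and their maximal heights
-- strictly decrease. The height is thus bounded by the rule height times the number of such states
-- (`height_le_of_finite`). As ⊥ is not among them, a tree higher than G forces an infinite set.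

universe w

/-! ### The order on positions -/

theorem posLT_nil_left (w : List ℕ) : ¬ PosLT [] w := by
  rintro (⟨i, x, h⟩ | ⟨r, i, j, x, y, h, -⟩) <;> simp at h

theorem posLT_cons_nil (i : ℕ) (v : List ℕ) : PosLT (i :: v) [] :=
  Or.inl ⟨i, v, rfl⟩

theorem posLT_cons_cons {i j : ℕ} {v w : List ℕ} :
    PosLT (i :: v) (j :: w) ↔ i < j ∨ (i = j ∧ PosLT v w) := by
  constructor
  · rintro (⟨k, x, h⟩ | ⟨r, k, l, x, y, h, h', hkl⟩)
    · simp only [List.cons_append, List.cons.injEq] at h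
      exact Or.inr ⟨h.1, Or.inl ⟨k, x, h.2⟩⟩
    · cases r with
      | nil => simp_all
      | cons b r =>
        simp only [List.cons_append, List.cons.injEq] at h h'
        exact Or.inr ⟨h.1.trans h'.1.symm, Or.inr ⟨r, k, l, x, y, h.2, h'.2, hkl⟩⟩
  · rintro (h | ⟨rfl, ⟨k, x, h⟩ | ⟨r, k, l, x, y, h, h', hkl⟩⟩)
    · exact Or.inr ⟨[], i, j, v, w, rfl, rfl, h⟩
    · exact Or.inl ⟨k, x, by simp [h]⟩
    · exact Or.inr ⟨i :: r, k, l, x, y, by simp [h], by simp [h'], hkl⟩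

theorem PosLT.trans {a b c : List ℕ} (h : PosLT a b) (h' : PosLT b c) : PosLT a c := by
  induction a generalizing b c with
  | nil => exact absurd h (posLT_nil_left _)
  | cons i a ih =>
    cases c with
    | nil => exact posLT_cons_nil _ _
    | cons k c =>
      cases b with
      | nil => exact absurd h' (posLT_nil_left _)
      | cons j b =>
        rw [posLT_cons_cons] at h h' ⊢
        rcases h with h | ⟨rfl, h⟩ <;> rcases h' with h' | ⟨rfl, h'⟩
        · exact Or.inl (h.trans h')
        · exact Or.inl h
        · exact Or.inl h'
        · exact Or.inr ⟨rfl, ih h h'⟩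

theorem PosLT.asymm {a b : List ℕ} (h : PosLT a b) : ¬ PosLT b a :=
  fun h' => (h.trans h').ne rfl

theorem posLT_trichotomy (a b : List ℕ) : PosLT a b ∨ a = b ∨ PosLT b a := by
  induction a generalizing b with
  | nil =>
    cases b with
    | nil => simp
    | cons j b => exact Or.inr (Or.inr (posLT_cons_nil _ _))
  | cons i a ih =>
    cases b with
    | nil => exact Or.inl (posLT_cons_nil _ _)
    | cons j b =>
      simp only [posLT_cons_cons, List.cons.injEq]
      rcases lt_trichotomy i j with h | rfl | h
      · simp [h]
      · rcases ih b with h | h | h <;> simp [h]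
      · simp [h]

/-- Finiteness is essential: extending a position makes it smaller, so the order is not
well-founded. -/
theorem exists_posLT_minimal {s : Set (List ℕ)} (hs : s.Finite) (hne : s.Nonempty) :
    ∃ v ∈ s, ∀ w ∈ s, ¬ PosLT w v := by
  have : IsStrictOrder (List ℕ) PosLT :=
    { irrefl := fun a h => h.ne rfl, trans := fun a b c => PosLT.trans }
  have hwf := hs.wellFoundedOn (r := PosLT)
  obtain ⟨v, hv⟩ := hwf.has_min Set.univ ⟨⟨_, hne.some_mem⟩, trivial⟩
  exact ⟨v.1, v.2, fun w hw => hv.2 ⟨w, hw⟩ trivial⟩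

/-! ### Substitution, leaves and heights of trees -/

namespace RTree

variable {A : Type u} {rk : A → ℕ} {Z Z' Z'' : Type*}

/-- Replace every leaf labeled `z` at position `w` by the tree `ρ w z`. -/
def bindPos : RTree rk Z → (List ℕ → Z → RTree rk Z') → RTree rk Z'
  | var z, ρ => ρ [] z
  | node a ts, ρ => node a fun i => (ts i).bindPos fun w => ρ (i.1 :: w)

/-- Replace every leaf labeled `z` by the tree `θ z`. -/
def bind (t : RTree rk Z) (θ : Z → RTree rk Z') : RTree rk Z' := t.bindPos fun _ => θ

/-- Relabel the leaf labeled `z` at position `w` by `f w z`. -/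
def mapPos (t : RTree rk Z) (f : List ℕ → Z → Z') : RTree rk Z' :=
  t.bindPos fun w z => var (f w z)

@[simp] theorem bind_var (z : Z) (θ : Z → RTree rk Z') : (var z).bind θ = θ z := rfl

@[simp] theorem bind_node (a : A) (ts : Fin (rk a) → RTree rk Z) (θ : Z → RTree rk Z') :
    (node a ts).bind θ = node a fun i => (ts i).bind θ := rfl

theorem bindPos_bindPos (t : RTree rk Z) (ρ : List ℕ → Z → RTree rk Z')
    (θ : Z' → RTree rk Z'') :
    (t.bindPos ρ).bind θ = t.bindPos fun w z => (ρ w z).bind θ := by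
  induction t generalizing ρ with
  | var z => rfl
  | node a ts ih => simp only [bindPos, bind_node, ih]

theorem bind_bind (t : RTree rk Z) (σ : Z → RTree rk Z') (θ : Z' → RTree rk Z'') :
    (t.bind σ).bind θ = t.bind fun z => (σ z).bind θ :=
  bindPos_bindPos t _ θ

theorem mapPos_bindPos (t : RTree rk Z) (f : List ℕ → Z → Z')
    (ρ : List ℕ → Z' → RTree rk Z'') :
    (t.mapPos f).bindPos ρ = t.bindPos fun w z => ρ w (f w z) := by
  induction t generalizing f ρ with
  | var z => rfl
  | node a ts ih =>
    simp only [mapPos, bindPos] at ih ⊢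
    congr 1
    funext i
    exact ih i _ _

theorem mapPos_ne_var {t : RTree rk Z} (ht : ∀ z, t ≠ var z) (f : List ℕ → Z → Z') (z : Z') :
    t.mapPos f ≠ var z := by
  cases t with
  | var y => exact absurd rfl (ht y)
  | node a ts => exact fun h => by cases h

open Classical in
/-- The leaves labeled in `Z`, with their positions. -/
noncomputable def leaves : RTree rk Z → Finset (List ℕ × Z)
  | var z => {([], z)}
  | node _ ts => Finset.univ.biUnion fun i => (ts i).leaves.image fun x => (i.1 :: x.1, x.2)

theorem mem_leaves {t : RTree rk Z} {w : List ℕ} {z : Z} :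
    (w, z) ∈ t.leaves ↔ t.subtree? w = some (var z) := by
  induction t generalizing w with
  | var y =>
    cases w with
    | nil => simp [leaves, subtree?, eq_comm]
    | cons i w => simp [leaves, subtree?]
  | node a ts ih =>
    simp only [leaves, Finset.mem_biUnion, Finset.mem_univ, true_and, Finset.mem_image,
      Prod.exists, Prod.mk.injEq]
    cases w with
    | nil => simp [subtree?]
    | cons i w =>
      simp only [subtree?, List.cons.injEq]
      constructor
      · rintro ⟨j, x, y, h, ⟨rfl, rfl⟩, rfl⟩
        simpa using (ih j).1 h
      · intro h
        by_cases hi : i < rk a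
        · rw [dif_pos hi] at h
          exact ⟨⟨i, hi⟩, w, z, (ih _).2 h, ⟨rfl, rfl⟩, rfl⟩
        · simp [hi] at h

theorem prod_leaves_node {a : A} (ts : Fin (rk a) → RTree rk Z) (g : List ℕ × Z → ℕ) :
    ∏ x ∈ (node a ts).leaves, g x = ∏ i, ∏ x ∈ (ts i).leaves, g (i.1 :: x.1, x.2) := by
  classical
  rw [leaves, Finset.prod_biUnion]
  · refine Finset.prod_congr rfl fun i _ => ?_
    rw [Finset.prod_image]
    rintro ⟨x, z⟩ _ ⟨y, z'⟩ _ h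
    simpa using h
  · intro i _ j _ hij
    rw [Function.onFun, Finset.disjoint_left]
    rintro ⟨x, z⟩ h h'
    simp only [Finset.mem_image, Prod.exists, Prod.mk.injEq] at h h'
    obtain ⟨_, _, _, rfl, _⟩ := h
    obtain ⟨_, _, _, h', _⟩ := h'
    simp only [List.cons.injEq] at h'
    exact hij (Fin.ext h'.1.symm)

theorem subtree?_bindPos {t : RTree rk Z} {w : List ℕ} {z : Z}
    (h : t.subtree? w = some (var z)) (ρ : List ℕ → Z → RTree rk Z') :
    (t.bindPos ρ).subtree? w = some (ρ w z) := by
  induction t generalizing w ρ with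
  | var y =>
    cases w with
    | nil => simp only [subtree?, Option.some.injEq, var.injEq] at h ⊢; rw [h]; rfl
    | cons i w => simp [subtree?] at h
  | node a ts ih =>
    cases w with
    | nil => simp [subtree?] at h
    | cons i w =>
      by_cases hi : i < rk a
      · simp only [subtree?, bindPos, hi, dite_true] at h ⊢
        exact ih _ h _
      · simp [subtree?, hi] at h

theorem bindPos_congr {t : RTree rk Z} {ρ ρ' : List ℕ → Z → RTree rk Z'}
    (h : ∀ w z, (w, z) ∈ t.leaves → ρ w z = ρ' w z) : t.bindPos ρ = t.bindPos ρ' := by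
  induction t generalizing ρ ρ' with
  | var z => exact h _ _ (by simp [leaves])
  | node a ts ih =>
    simp only [bindPos]
    congr 1
    funext i
    refine ih i fun w z hw => h _ _ ?_
    rw [mem_leaves] at hw ⊢
    simpa [subtree?] using hw

/-- A substitution can be read off its result at the leaf positions; this makes matching against a
term unambiguous. -/
theorem eq_of_bindPos_eq {t : RTree rk Z} {ρ ρ' : List ℕ → Z → RTree rk Z'}
    (h : t.bindPos ρ = t.bindPos ρ') {w : List ℕ} {z : Z} (hw : (w, z) ∈ t.leaves) :
    ρ w z = ρ' w z := by
  rw [mem_leaves] at hw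
  have := subtree?_bindPos hw ρ
  rw [h, subtree?_bindPos hw ρ'] at this
  exact (Option.some.inj this).symm

theorem leaves_mapPos_iff {t : RTree rk Z} {f : List ℕ → Z → Z'} {w : List ℕ} {y : Z'} :
    (w, y) ∈ (t.mapPos f).leaves ↔ ∃ z, (w, z) ∈ t.leaves ∧ f w z = y := by
  induction t generalizing f w with
  | var z =>
    simp only [mapPos, bindPos, leaves, Finset.mem_singleton, Prod.mk.injEq]
    constructor
    · rintro ⟨rfl, rfl⟩; exact ⟨z, ⟨rfl, rfl⟩, rfl⟩
    · rintro ⟨_, ⟨rfl, rfl⟩, rfl⟩; exact ⟨rfl, rfl⟩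
  | node a ts ih =>
    simp only [mem_leaves, mapPos] at ih ⊢
    cases w with
    | nil => simp [subtree?, bindPos]
    | cons i w =>
      by_cases hi : i < rk a
      · simp only [subtree?, bindPos, hi, dite_true]
        exact ih ⟨i, hi⟩ (f := fun w => f (i :: w))
      · simp [subtree?, bindPos, hi]

theorem leaves_eq_image_mapPos [DecidableEq (List ℕ × Z')] (t : RTree rk Z)
    (f : List ℕ → Z → Z') :
    (t.mapPos f).leaves = t.leaves.image fun x => (x.1, f x.1 x.2) := by
  ext ⟨w, y⟩
  simp only [leaves_mapPos_iff, Finset.mem_image, Prod.exists, Prod.mk.injEq]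
  constructor
  · rintro ⟨z, h, rfl⟩; exact ⟨w, z, h, rfl, rfl⟩
  · rintro ⟨_, z, h, rfl, rfl⟩; exact ⟨z, h, rfl⟩

theorem leaf_unique {t : RTree rk Z} {w : List ℕ} {y z : Z} (h : (w, y) ∈ t.leaves)
    (h' : (w, z) ∈ t.leaves) : y = z := by
  rw [mem_leaves] at h h'
  simpa using h.symm.trans h'

open Classical in
/-- The set of leaf labels. -/
noncomputable def vars (t : RTree rk Z) : Finset Z := t.leaves.image Prod.snd

theorem mem_vars {t : RTree rk Z} {z : Z} : z ∈ t.vars ↔ ∃ w, (w, z) ∈ t.leaves := by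
  simp [vars]

@[simp] theorem vars_var (z : Z) : (var z : RTree rk Z).vars = {z} := by
  simp [vars, leaves]

theorem bind_congr {t : RTree rk Z} {θ θ' : Z → RTree rk Z'} (h : ∀ z ∈ t.vars, θ z = θ' z) :
    t.bind θ = t.bind θ' :=
  bindPos_congr fun w z hw => h z (mem_vars.2 ⟨w, hw⟩)

theorem eq_of_bind_eq {t : RTree rk Z} {θ θ' : Z → RTree rk Z'} (h : t.bind θ = t.bind θ')
    {z : Z} (hz : z ∈ t.vars) : θ z = θ' z := by
  obtain ⟨w, hw⟩ := mem_vars.1 hz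
  exact eq_of_bindPos_eq h hw

theorem mem_vars_node {a : A} {ts : Fin (rk a) → RTree rk Z} {z : Z} :
    z ∈ (node a ts).vars ↔ ∃ i, z ∈ (ts i).vars := by
  simp only [mem_vars, mem_leaves]
  constructor
  · rintro ⟨_ | ⟨i, w⟩, h⟩
    · simp [subtree?] at h
    · by_cases hi : i < rk a
      · exact ⟨⟨i, hi⟩, w, by simpa [subtree?, hi] using h⟩
      · simp [subtree?, hi] at h
  · rintro ⟨i, w, h⟩
    exact ⟨i.1 :: w, by simpa [subtree?] using h⟩

theorem mem_vars_bind {t : RTree rk Z} {σ : Z → RTree rk Z'} {y : Z'} :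
    y ∈ (t.bind σ).vars ↔ ∃ z ∈ t.vars, y ∈ (σ z).vars := by
  induction t with
  | var z => simp
  | node a ts ih =>
    simp only [bind_node, mem_vars_node, ih]
    constructor
    · rintro ⟨i, z, h, h'⟩; exact ⟨z, ⟨i, h⟩, h'⟩
    · rintro ⟨z, ⟨i, h⟩, h'⟩; exact ⟨i, z, h, h'⟩

theorem mem_leaves_bind {t : RTree rk Z} {σ : Z → RTree rk Z'} {w x : List ℕ} {z : Z} {y : Z'}
    (hw : (w, z) ∈ t.leaves) (hx : (x, y) ∈ (σ z).leaves) : (w ++ x, y) ∈ (t.bind σ).leaves := by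
  induction t generalizing w with
  | var z' =>
    simp only [leaves, Finset.mem_singleton, Prod.mk.injEq] at hw
    obtain ⟨rfl, rfl⟩ := hw
    exact hx
  | node a ts ih =>
    simp only [mem_leaves] at *
    cases w with
    | nil => simp [subtree?] at hw
    | cons i w =>
      by_cases hi : i < rk a
      · simp only [subtree?, hi, dite_true, List.cons_append, bind_node] at hw ⊢
        exact ih _ hw
      · simp [subtree?, hi] at hw

theorem height_mapPos (t : RTree rk Z) (f : List ℕ → Z → Z') : (t.mapPos f).height = t.height := by
  induction t generalizing f with
  | var z => rfl
  | node a ts ih =>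
    simp only [mapPos, bindPos, height] at ih ⊢
    exact Finset.sup_congr rfl fun i _ => by rw [ih i]

/-- A longest path either ends inside the term or passes through a leaf into a substituted tree. -/
theorem height_bind_le {t : RTree rk Z} {θ : Z → RTree rk Z'} :
    (t.bind θ).height ≤ t.height ∨
      ∃ z ∈ t.vars, (t.bind θ).height ≤ t.height + (θ z).height := by
  induction t with
  | var z => exact Or.inr ⟨z, by simp, by simp [height]⟩
  | node a ts ih =>
    by_cases h : ∃ i : Fin (rk a), ((node a ts).bind θ).height = ((ts i).bind θ).height + 1
    · obtain ⟨i, hi⟩ := h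
      have hle : (ts i).height + 1 ≤ (node a ts).height := by
        rw [height]
        exact Finset.le_sup (f := fun i => (ts i).height + 1) (Finset.mem_univ i)
      rcases ih i with h | ⟨z, hz, h⟩
      · left; omega
      · right; exact ⟨z, mem_vars_node.2 ⟨i, hz⟩, by omega⟩
    · left
      -- If no child realizes the supremum, there is no child at all.
      have : ((node a ts).bind θ).height = 0 := by
        by_contra hne
        apply h
        simp only [bind_node, height] at hne ⊢
        have hn : (Finset.univ : Finset (Fin (rk a))).Nonempty := by
          by_contra hn
          rw [Finset.not_nonempty_iff_eq_empty] at hn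
          simp [hn] at hne
        obtain ⟨i, -, hi⟩ := Finset.exists_mem_eq_sup _ hn
          (fun i => ((ts i).bind θ).height + 1)
        exact ⟨i, hi⟩
      omega

theorem height_le_height_bind {t : RTree rk Z} {θ : Z → RTree rk Z'} {z : Z} (hz : z ∈ t.vars) :
    (θ z).height ≤ (t.bind θ).height := by
  induction t with
  | var y => simp_all
  | node a ts ih =>
    obtain ⟨i, hi⟩ := mem_vars_node.1 hz
    have := ih i hi
    rw [bind_node, height]
    have h2 := Finset.le_sup (f := fun i => ((ts i).bind θ).height + 1) (Finset.mem_univ i)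
    omega

theorem height_lt_height_bind {t : RTree rk Z} (ht : ∀ z, t ≠ var z) {θ : Z → RTree rk Z'} {z : Z}
    (hz : z ∈ t.vars) : (θ z).height < (t.bind θ).height := by
  cases t with
  | var y => exact absurd rfl (ht y)
  | node a ts =>
    obtain ⟨i, hi⟩ := mem_vars_node.1 hz
    have := height_le_height_bind (θ := θ) hi
    rw [bind_node, height]
    have h2 := Finset.le_sup (f := fun i => ((ts i).bind θ).height + 1) (Finset.mem_univ i)
    omega

end RTree

/-! ### Decomposition of derivations and of their weights at the root -/

namespace RTree
variable {A : Type u} {rk : A → ℕ} {Z : Type*}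

theorem mem_pos_node {a : A} {ts : Fin (rk a) → RTree rk Z} {w : List ℕ}
    (h : w ∈ (node a ts).pos) (hw : w ≠ []) : ∃ (j : Fin (rk a)) (x : List ℕ), w = j.1 :: x := by
  cases w with
  | nil => exact absurd rfl hw
  | cons i w =>
    by_cases hi : i < rk a
    · exact ⟨⟨i, hi⟩, w, rfl⟩
    · simp [pos, subtree?, hi] at h

theorem subtree?_node_cons {a : A} (ts : Fin (rk a) → RTree rk Z) (j : Fin (rk a)) (w : List ℕ) :
    (node a ts).subtree? (j.1 :: w) = (ts j).subtree? w := by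
  simp [subtree?]

theorem subst_node_cons {a : A} (ts : Fin (rk a) → RTree rk Z) (j : Fin (rk a)) (w : List ℕ)
    (s : RTree rk Z) :
    (node a ts).subst (j.1 :: w) s = node a (Function.update ts j ((ts j).subst w s)) := by
  simp [subst]

end RTree

namespace WTGc

variable {A : Type u} {rk : A → ℕ} {S : Type v} {G : WTGc rk S}

open RTree

theorem derives_nil_iff {t : RTree rk Empty} {ξ ζ : RTree rk S} :
    G.Derives t ξ [] ζ ↔ ξ = ζ := by
  constructor
  · rintro ⟨⟩; rfl
  · rintro rfl; exact .nil _

theorem derives_cons_iff {t : RTree rk Empty} {ξ ζ : RTree rk S} {p : Production rk S}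
    {w : List ℕ} {d : List (Production rk S × List ℕ)} :
    G.Derives t ξ ((p, w) :: d) ζ ↔
      p ∈ G.P ∧ ξ.subtree? w = some p.lhs ∧ (∃ s, t.subtree? w = some s ∧
        Satisfies s p.constraints) ∧ G.Derives t (ξ.subst w (var p.target)) d ζ := by
  constructor
  · rintro (_ | ⟨⟨h1, h2, rfl, h4⟩, h5⟩)
    exact ⟨h1, h2, h4, h5⟩
  · rintro ⟨h1, h2, h4, h5⟩
    exact .cons ⟨h1, h2, rfl, h4⟩ h5

theorem derives_append_iff {t : RTree rk Empty} {ξ ζ : RTree rk S}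
    {d e : List (Production rk S × List ℕ)} :
    G.Derives t ξ (d ++ e) ζ ↔ ∃ η, G.Derives t ξ d η ∧ G.Derives t η e ζ := by
  induction d generalizing ξ with
  | nil => simp [derives_nil_iff]
  | cons x d ih =>
    obtain ⟨p, w⟩ := x
    simp only [List.cons_append, derives_cons_iff, ih]
    constructor
    · rintro ⟨h1, h2, h3, η, h4, h5⟩; exact ⟨η, ⟨h1, h2, h3, h4⟩, h5⟩
    · rintro ⟨η, ⟨h1, h2, h3, h4⟩, h5⟩; exact ⟨h1, h2, h3, η, h4, h5⟩

/-- No left-hand side is a single state, so a tree consisting of one state admits no further step.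
-/
theorem Derives.eq_of_var {t : RTree rk Empty} {q : S} {ζ : RTree rk S}
    {d : List (Production rk S × List ℕ)} (h : G.Derives t (var q) d ζ) : ζ = var q := by
  cases d with
  | nil => exact (derives_nil_iff.1 h).symm
  | cons x d =>
    obtain ⟨p, w⟩ := x
    obtain ⟨-, h, -⟩ := derives_cons_iff.1 h
    cases w with
    | nil => exact absurd (by simpa [subtree?] using h.symm) (p.lhs_ne_var q)
    | cons i w => simp [subtree?] at h

theorem Derives.eq_var_of_root {t : RTree rk Empty} {ξ ζ : RTree rk S}
    {d : List (Production rk S × List ℕ)} (h : G.Derives t ξ d ζ) {x : Production rk S × List ℕ}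
    (hx : x ∈ d) (hw : x.2 = []) : ∃ q, ζ = var q := by
  induction d generalizing ξ with
  | nil => simp at hx
  | cons y d ih =>
    obtain ⟨p, w⟩ := y
    obtain ⟨-, -, -, h⟩ := derives_cons_iff.1 h
    rcases List.mem_cons.1 hx with rfl | hx
    · simp only at hw
      subst hw
      rw [subst] at h
      exact ⟨_, h.eq_of_var⟩
    · exact ih h hx

/-- The part of `d` that takes place in the `i`-th direct subtree. -/
def proj (i : ℕ) (d : List (Production rk S × List ℕ)) : List (Production rk S × List ℕ) :=
  d.filterMap fun x => match x.2 with
    | [] => none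
    | j :: w => if j = i then some (x.1, w) else none

@[simp] theorem proj_nil (i : ℕ) : proj i ([] : List (Production rk S × List ℕ)) = [] := rfl

theorem proj_cons_self (i : ℕ) (p : Production rk S) (w : List ℕ)
    (d : List (Production rk S × List ℕ)) : proj i ((p, i :: w) :: d) = (p, w) :: proj i d := by
  simp [proj]

theorem proj_cons_of_ne {i j : ℕ} (h : j ≠ i) (p : Production rk S) (w : List ℕ)
    (d : List (Production rk S × List ℕ)) : proj i ((p, j :: w) :: d) = proj i d := by
  simp [proj, h]

theorem mem_proj {i : ℕ} {d : List (Production rk S × List ℕ)} {p : Production rk S}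
    {w : List ℕ} : (p, w) ∈ proj i d ↔ (p, i :: w) ∈ d := by
  simp only [proj, List.mem_filterMap, Prod.exists]
  constructor
  · rintro ⟨p', _ | ⟨j, w'⟩, h, h'⟩
    · simp at h'
    · simp only [Option.ite_none_right_eq_some, Option.some.injEq, Prod.mk.injEq] at h'
      obtain ⟨rfl, rfl, rfl⟩ := h'
      exact h
  · intro h
    exact ⟨p, i :: w, h, by simp⟩

/-- Steps below different children do not interact: a step reads and changes only one child, and its
constraints inspect only the input subtree at its own position. -/
theorem derives_node_iff {a : A} {ts : Fin (rk a) → RTree rk Empty}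
    {ξs ζs : Fin (rk a) → RTree rk S} {d : List (Production rk S × List ℕ)}
    (hd : ∀ x ∈ d, ∃ (j : Fin (rk a)) (w : List ℕ), x.2 = j.1 :: w) :
    G.Derives (node a ts) (node a ξs) d (node a ζs) ↔
      ∀ i, G.Derives (ts i) (ξs i) (proj i.1 d) (ζs i) := by
  induction d generalizing ξs with
  | nil => simp [derives_nil_iff, funext_iff]
  | cons x d ih =>
    obtain ⟨p, w⟩ := x
    obtain ⟨j, w, rfl⟩ := hd _ List.mem_cons_self
    specialize @ih (Function.update ξs j ((ξs j).subst w (var p.target)))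
      (fun x hx => hd x (List.mem_cons_of_mem _ hx))
    rw [derives_cons_iff, subtree?_node_cons, subtree?_node_cons, subst_node_cons, ih]
    constructor
    · rintro ⟨h1, h2, h3, h4⟩ i
      by_cases hij : j = i
      · subst hij
        rw [proj_cons_self, derives_cons_iff]
        exact ⟨h1, h2, h3, by simpa using h4 j⟩
      · rw [proj_cons_of_ne (by simpa [Fin.ext_iff] using hij)]
        simpa [Function.update_of_ne (Ne.symm hij)] using h4 i
    · intro h
      have hj := h j
      rw [proj_cons_self, derives_cons_iff] at hj
      refine ⟨hj.1, hj.2.1, hj.2.2.1, fun i => ?_⟩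
      by_cases hij : j = i
      · subst hij
        simpa using hj.2.2.2
      · have := h i
        rw [proj_cons_of_ne (by simpa [Fin.ext_iff] using hij)] at this
        simpa [Function.update_of_ne (Ne.symm hij)] using this

theorem Derives.eq_node {a : A} {ts : Fin (rk a) → RTree rk S} {t : RTree rk Empty}
    {ζ : RTree rk S} {d : List (Production rk S × List ℕ)} (h : G.Derives t (node a ts) d ζ)
    (hd : ∀ x ∈ d, ∃ (j : Fin (rk a)) (w : List ℕ), x.2 = j.1 :: w) : ∃ ζs, ζ = node a ζs := by
  induction d generalizing ts with
  | nil => exact ⟨ts, (derives_nil_iff.1 h).symm⟩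
  | cons x d ih =>
    obtain ⟨p, w⟩ := x
    obtain ⟨j, w, rfl⟩ := hd _ List.mem_cons_self
    rw [derives_cons_iff, subst_node_cons] at h
    exact ih h.2.2.2 fun x hx => hd x (List.mem_cons_of_mem _ hx)

/-- The left-most derivations for `t` that end in `ξ`. -/
def derivTo (G : WTGc rk S) (ξ : RTree rk S) (t : RTree rk Empty) :
    Set (List (Production rk S × List ℕ)) :=
  {d | G.Derives t (t.incl S) d ξ ∧ d.Pairwise fun x y => PosLT x.2 y.2}

/-- A left-most derivation is determined by its set of steps, which reduces equality of derivations
to membership. -/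
theorem eq_of_pairwise_posLT {d e : List (Production rk S × List ℕ)}
    (hd : d.Pairwise fun x y => PosLT x.2 y.2) (he : e.Pairwise fun x y => PosLT x.2 y.2)
    (h : ∀ x, x ∈ d ↔ x ∈ e) : d = e := by
  have hd' : d.Nodup := hd.imp fun h e => h.ne (by rw [e])
  have he' : e.Nodup := he.imp fun h e => h.ne (by rw [e])
  refine List.Perm.eq_of_pairwise (fun a b _ _ h h' => absurd h' h.asymm) hd he ?_
  exact (List.perm_ext_iff_of_nodup hd' he').2 h

theorem derivTo_finite (G : WTGc rk S) (ξ : RTree rk S) (t : RTree rk Empty) :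
    (G.derivTo ξ t).Finite := by
  classical
  have hfin : ((G.P : Set (Production rk S)) ×ˢ (t.incl S).pos).Finite :=
    G.P.finite_toSet.prod (RTree.pos_finite _)
  refine Set.Finite.of_finite_image (f := fun d => {x | x ∈ d})
    (hfin.finite_subsets.subset ?_) ?_
  · rintro _ ⟨d, hd, rfl⟩ x hx
    exact hd.1.mem x hx
  · intro d hd e he h
    exact eq_of_pairwise_posLT hd.2 he.2 fun x => Set.ext_iff.1 h x

theorem mem_derivTo_node {a : A} {ts : Fin (rk a) → RTree rk Empty}
    {ξs : Fin (rk a) → RTree rk S} {d : List (Production rk S × List ℕ)} :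
    d ∈ G.derivTo (node a ξs) (node a ts) ↔
      (∀ x ∈ d, ∃ (j : Fin (rk a)) (w : List ℕ), x.2 = j.1 :: w) ∧
      (d.Pairwise fun x y => PosLT x.2 y.2) ∧
      ∀ i, proj i.1 d ∈ G.derivTo (ξs i) (ts i) := by
  have hproj (i : ℕ) (h : d.Pairwise fun x y => PosLT x.2 y.2) :
      (proj i d).Pairwise fun x y => PosLT x.2 y.2 := by
    rw [proj, List.pairwise_filterMap]
    refine h.imp ?_
    rintro ⟨p, _ | ⟨j, x⟩⟩ ⟨p', _ | ⟨j', x'⟩⟩ h y hy y' hy' <;> simp at hy hy'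
    obtain ⟨rfl, rfl⟩ := hy
    obtain ⟨rfl, rfl⟩ := hy'
    rw [posLT_cons_cons] at h
    simpa using h
  constructor
  · rintro ⟨h, h'⟩
    have hd : ∀ x ∈ d, ∃ (j : Fin (rk a)) (w : List ℕ), x.2 = j.1 :: w := by
      intro x hx
      refine mem_pos_node (h.mem x hx).2 fun hw => ?_
      obtain ⟨q, hq⟩ := h.eq_var_of_root hx hw
      cases hq
    exact ⟨hd, h', fun i => ⟨(derives_node_iff hd).1 h i, hproj _ h'⟩⟩
  · rintro ⟨hd, h', h⟩
    exact ⟨(derives_node_iff hd).2 fun i => (h i).1, h'⟩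

theorem derivTo_node_of_ne {a b : A} (hab : a ≠ b) (ts : Fin (rk b) → RTree rk Empty)
    (ξs : Fin (rk a) → RTree rk S) : G.derivTo (node a ξs) (node b ts) = ∅ := by
  rw [Set.eq_empty_iff_forall_notMem]
  rintro d ⟨h, -⟩
  have hd : ∀ x ∈ d, ∃ (j : Fin (rk b)) (w : List ℕ), x.2 = j.1 :: w := by
    intro x hx
    refine mem_pos_node (h.mem x hx).2 fun hw => ?_
    obtain ⟨q, hq⟩ := h.eq_var_of_root hx hw
    cases hq
  obtain ⟨ζs, h⟩ := Derives.eq_node h hd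
  cases h
  exact hab rfl

/-- The root is larger than every other position, so a derivation to a state consists of a
derivation to some left-hand side followed by one root step. -/
theorem mem_derivTo_var {q : S} {t : RTree rk Empty} {d : List (Production rk S × List ℕ)} :
    d ∈ G.derivTo (var q) t ↔ ∃ p d', d = d' ++ [(p, [])] ∧ p ∈ G.P ∧ p.target = q ∧
      Satisfies t p.constraints ∧ d' ∈ G.derivTo p.lhs t := by
  constructor
  · rintro ⟨h, h'⟩
    rcases d.eq_nil_or_concat with rfl | ⟨d', ⟨p, w⟩, rfl⟩
    · rw [derives_nil_iff] at h
      cases t with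
      | var z => exact z.elim
      | node a ts => cases h
    · rw [List.concat_eq_append] at h h' ⊢
      obtain ⟨η, h1, h2⟩ := derives_append_iff.1 h
      rw [derives_cons_iff, derives_nil_iff] at h2
      obtain ⟨hp, hη, ⟨s, hs, hsat⟩, he⟩ := h2
      rw [List.pairwise_append] at h'
      cases w with
      | nil =>
        simp only [subtree?, Option.some.injEq] at hη hs
        simp only [subst, var.injEq] at he
        subst hη hs
        exact ⟨p, d', rfl, hp, he, hsat, h1, h'.1⟩
      | cons i w =>
        exfalso
        -- A last step strictly below the root would leave a node at the root, not a state.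
        cases η with
        | var z => simp [subtree?] at hη
        | node a ts =>
          by_cases hi : i < rk a <;> simp [subst, hi] at he
  · rintro ⟨p, d', rfl, hp, rfl, hsat, h, h'⟩
    refine ⟨derives_append_iff.2 ⟨_, h, derives_cons_iff.2 ⟨hp, by simp [subtree?],
      ⟨t, by simp [subtree?], hsat⟩, by rw [subst]; exact .nil _⟩⟩, ?_⟩
    rw [List.pairwise_append]
    refine ⟨h', by simp, ?_⟩
    intro x hx y hy
    rw [List.mem_singleton.1 hy]
    rcases hw : x.2 with _ | ⟨i, w⟩
    · obtain ⟨q, hq⟩ := h.eq_var_of_root hx hw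
      exact absurd hq (p.lhs_ne_var q)
    · exact posLT_cons_nil _ _

/-- The total weight of the left-most derivations for `t` that end in `ξ`. -/
noncomputable def weight (G : WTGc rk S) (ξ : RTree rk S) (t : RTree rk Empty) : ℕ :=
  ∑ d ∈ (G.derivTo_finite ξ t).toFinset, G.derivWt d

theorem sem_eq [Fintype S] (t : RTree rk Empty) :
    G.sem t = ∑ q, G.F q * G.weight (var q) t := by
  refine Finset.sum_congr rfl fun q _ => ?_
  rw [weight, Finset.mul_sum]
  exact finsum_mem_eq_finite_toFinset_sum _ (G.derivTo_finite (var q) t)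

theorem derivWt_eq_prod {k : ℕ} {d : List (Production rk S × List ℕ)}
    (hd : ∀ x ∈ d, ∃ (j : Fin k) (w : List ℕ), x.2 = j.1 :: w) :
    G.derivWt d = ∏ i : Fin k, G.derivWt (proj i.1 d) := by
  induction d with
  | nil => simp [derivWt]
  | cons x d ih =>
    obtain ⟨p, w⟩ := x
    obtain ⟨j, w, rfl⟩ := hd _ List.mem_cons_self
    specialize ih fun x hx => hd x (List.mem_cons_of_mem _ hx)
    have h (i : Fin k) : G.derivWt (proj i.1 ((p, j.1 :: w) :: d)) =
        (if i = j then G.wt p else 1) * G.derivWt (proj i.1 d) := by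
      split_ifs with hij
      · subst hij
        rw [proj_cons_self]
        simp [derivWt]
      · rw [proj_cons_of_ne (by simpa [Fin.ext_iff, eq_comm] using hij), one_mul]
    simp only [h, Finset.prod_mul_distrib, ← ih]
    simp [derivWt]

/-- Projection to the children is a bijection between derivations and tuples of derivations, and the
weight is multiplicative along it. -/
theorem weight_node {a : A} (ξs : Fin (rk a) → RTree rk S) (ts : Fin (rk a) → RTree rk Empty) :
    G.weight (node a ξs) (node a ts) = ∏ i, G.weight (ξs i) (ts i) := by
  classical
  simp only [weight]
  rw [Finset.prod_univ_sum]
  refine Finset.sum_nbij (fun d i => proj i.1 d) ?_ ?_ ?_ ?_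
  · intro d hd
    rw [Set.Finite.mem_toFinset, mem_derivTo_node] at hd
    simpa [Fintype.mem_piFinset] using hd.2.2
  · intro d hd e he h
    rw [Finset.mem_coe, Set.Finite.mem_toFinset, mem_derivTo_node] at hd he
    have key : ∀ {d e : List (Production rk S × List ℕ)},
        (∀ x ∈ d, ∃ (j : Fin (rk a)) (w : List ℕ), x.2 = j.1 :: w) →
        (∀ i : Fin (rk a), proj i.1 d = proj i.1 e) → ∀ x ∈ d, x ∈ e := by
      rintro d e hd h ⟨p, w⟩ hx
      obtain ⟨j, w, rfl⟩ := hd _ hx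
      rw [← mem_proj] at hx ⊢
      rwa [← h]
    have h (i : Fin (rk a)) : proj i.1 d = proj i.1 e := congrFun h i
    exact eq_of_pairwise_posLT hd.2.1 he.2.1 fun x =>
      ⟨key hd.1 h x, key he.1 (fun i => (h i).symm) x⟩
  · intro e he
    simp only [Finset.mem_coe, Fintype.mem_piFinset, Set.Finite.mem_toFinset] at he
    -- The only left-most interleaving is concatenation, since all positions below an earlier child
    -- precede those below a later one.
    let d : List (Production rk S × List ℕ) :=
      (List.finRange (rk a)).flatMap fun i => (e i).map fun x => (x.1, i.1 :: x.2)
    have hmem {p : Production rk S} {i : Fin (rk a)} {w : List ℕ} :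
        (p, i.1 :: w) ∈ d ↔ (p, w) ∈ e i := by
      simp only [d, List.mem_flatMap, List.mem_finRange, true_and, List.mem_map, Prod.exists,
        Prod.mk.injEq, List.cons.injEq]
      constructor
      · rintro ⟨j, p, w, h, rfl, hj, rfl⟩
        rwa [← Fin.ext hj]
      · intro h
        exact ⟨i, p, w, h, rfl, rfl, rfl⟩
    have hd : ∀ x ∈ d, ∃ (j : Fin (rk a)) (w : List ℕ), x.2 = j.1 :: w := by
      intro x hx
      simp only [d, List.mem_flatMap, List.mem_finRange, true_and, List.mem_map] at hx
      obtain ⟨i, y, -, rfl⟩ := hx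
      exact ⟨i, _, rfl⟩
    have hsort : d.Pairwise fun x y => PosLT x.2 y.2 := by
      rw [List.pairwise_flatMap]
      constructor
      · intro i _
        rw [List.pairwise_map]
        exact (he i).2.imp fun h => posLT_cons_cons.2 (Or.inr ⟨rfl, h⟩)
      · refine (List.pairwise_lt_finRange _).imp fun {i j} hij x hx y hy => ?_
        simp only [List.mem_map] at hx hy
        obtain ⟨_, _, rfl⟩ := hx
        obtain ⟨_, _, rfl⟩ := hy
        exact posLT_cons_cons.2 (Or.inl hij)
    have hproj (i : Fin (rk a)) : proj i.1 d = e i := by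
      refine eq_of_pairwise_posLT ?_ (he i).2 fun x => mem_proj.trans hmem
      rw [proj, List.pairwise_filterMap]
      refine hsort.imp ?_
      rintro ⟨p, _ | ⟨j, x⟩⟩ ⟨p', _ | ⟨j', x'⟩⟩ h y hy y' hy' <;> simp at hy hy'
      obtain ⟨rfl, rfl⟩ := hy
      obtain ⟨rfl, rfl⟩ := hy'
      rw [posLT_cons_cons] at h
      simpa using h
    refine ⟨d, ?_, funext hproj⟩
    rw [Finset.mem_coe, Set.Finite.mem_toFinset, mem_derivTo_node]
    exact ⟨hd, hsort, fun i => by rw [hproj]; exact he i⟩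
  · intro d hd
    rw [Set.Finite.mem_toFinset, mem_derivTo_node] at hd
    exact derivWt_eq_prod hd.1

theorem weight_node_of_ne {a b : A} (hab : a ≠ b) (ξs : Fin (rk a) → RTree rk S)
    (ts : Fin (rk b) → RTree rk Empty) : G.weight (node a ξs) (node b ts) = 0 := by
  simp only [weight, derivTo_node_of_ne hab]
  simp

open Classical in
theorem weight_var (q : S) (t : RTree rk Empty) :
    G.weight (var q) t = ∑ p ∈ G.P, if p.target = q ∧ Satisfies t p.constraints then
      G.wt p * G.weight p.lhs t else 0 := by
  rw [← Finset.sum_filter]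
  simp only [weight, Finset.mul_sum]
  rw [Finset.sum_sigma']
  symm
  refine Finset.sum_bij (fun x _ => x.2 ++ [(x.1, [])]) ?_ ?_ ?_ ?_
  · rintro ⟨p, d⟩ h
    simp only [Finset.mem_sigma, Finset.mem_filter, Set.Finite.mem_toFinset] at h ⊢
    exact mem_derivTo_var.2 ⟨p, d, rfl, h.1.1, h.1.2.1, h.1.2.2, h.2⟩
  · rintro ⟨p, d⟩ h ⟨p', d'⟩ h' e
    simp only [List.append_singleton_inj] at e
    obtain ⟨rfl, e⟩ := e
    simp only [Prod.mk.injEq, and_true] at e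
    rw [e]
  · intro d hd
    rw [Set.Finite.mem_toFinset] at hd
    obtain ⟨p, d', rfl, hp, hq, hsat, hd'⟩ := mem_derivTo_var.1 hd
    exact ⟨⟨p, d'⟩, by simp [hp, hq, hsat, hd'], rfl⟩
  · rintro ⟨p, d⟩ h
    simp [derivWt, mul_comm]

theorem weight_bindPos (ξ : RTree rk S) (ρ : List ℕ → S → RTree rk Empty) :
    G.weight ξ (ξ.bindPos ρ) = ∏ x ∈ ξ.leaves, G.weight (var x.2) (ρ x.1 x.2) := by
  induction ξ generalizing ρ with
  | var q => simp [bindPos, leaves]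
  | node a ξs ih => simp only [bindPos, weight_node, ih, prod_leaves_node]

theorem exists_eq_bindPos_of_weight_ne_zero {ξ : RTree rk S} {t : RTree rk Empty}
    (h : G.weight ξ t ≠ 0) : ∃ ρ : List ℕ → S → RTree rk Empty, t = ξ.bindPos ρ := by
  induction ξ generalizing t with
  | var q => exact ⟨fun _ _ => t, rfl⟩
  | node a ξs ih =>
    cases t with
    | var z => exact z.elim
    | node b ts =>
      by_cases hab : a = b
      · subst hab
        rw [weight_node, Finset.prod_ne_zero_iff] at h
        choose ρ hρ using fun i => ih i (h i (Finset.mem_univ i))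
        refine ⟨fun w q => match w with
          | [] => node a ts
          | i :: w => if hi : i < rk a then ρ ⟨i, hi⟩ w q else node a ts, ?_⟩
        simp only [bindPos, Fin.is_lt, dite_true, Fin.eta]
        congr 1
        funext i
        exact hρ i
      · exact absurd (weight_node_of_ne hab ξs ts) h

end WTGc

/-! ### Matching trees against nonlinear terms -/

namespace RTree

variable {A : Type u} {rk : A → ℕ} {Z Z' X Y : Type*}

theorem mapPos_id (t : RTree rk Z) : (t.mapPos fun _ z => z) = t := by
  induction t with
  | var z => rfl
  | node a ts ih => simp only [mapPos, bindPos] at ih ⊢; simp only [ih]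

theorem prod_leaves_mapPos (t : RTree rk Z) (f : List ℕ → Z → Z') (g : List ℕ × Z' → ℕ) :
    ∏ x ∈ (t.mapPos f).leaves, g x = ∏ x ∈ t.leaves, g (x.1, f x.1 x.2) := by
  classical
  rw [leaves_eq_image_mapPos, Finset.prod_image]
  rintro ⟨w, z⟩ h ⟨w', z'⟩ h' e
  simp only [Prod.mk.injEq] at e
  obtain ⟨rfl, -⟩ := e
  rw [leaf_unique h h']

open Classical in
/-- The sum over all substitutions `θ` with `ℓ θ = t` (there is at most one on the variables of `ℓ`)
of the products of the weights of the substituted trees. -/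
noncomputable def matchWt (ℓ : RTree rk X) (w : X → RTree rk Empty → ℕ) (t : RTree rk Empty) : ℕ :=
  if h : ∃ θ : X → RTree rk Empty, ℓ.bind θ = t then ∏ x ∈ ℓ.vars, w x (h.choose x) else 0

/-- The chosen match agrees with θ on the variables of ℓ, so the choice is harmless. -/
theorem matchWt_bind (ℓ : RTree rk X) (w : X → RTree rk Empty → ℕ) (θ : X → RTree rk Empty) :
    ℓ.matchWt w (ℓ.bind θ) = ∏ x ∈ ℓ.vars, w x (θ x) := by
  have h : ∃ θ' : X → RTree rk Empty, ℓ.bind θ' = ℓ.bind θ := ⟨θ, rfl⟩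
  rw [matchWt, dif_pos h]
  exact Finset.prod_congr rfl fun x hx => by rw [eq_of_bind_eq h.choose_spec hx]

theorem matchWt_eq_zero {ℓ : RTree rk X} {t : RTree rk Empty}
    (h : ¬ ∃ θ : X → RTree rk Empty, ℓ.bind θ = t) (w : X → RTree rk Empty → ℕ) :
    ℓ.matchWt w t = 0 := by
  rw [matchWt, dif_neg h]

theorem exists_of_matchWt_ne_zero {ℓ : RTree rk X} {t : RTree rk Empty}
    {w : X → RTree rk Empty → ℕ} (h : ℓ.matchWt w t ≠ 0) :
    ∃ θ : X → RTree rk Empty, ℓ.bind θ = t ∧ ∀ x ∈ ℓ.vars, w x (θ x) ≠ 0 := by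
  by_cases h' : ∃ θ : X → RTree rk Empty, ℓ.bind θ = t
  · obtain ⟨θ, rfl⟩ := h'
    rw [matchWt_bind, Finset.prod_ne_zero_iff] at h
    exact ⟨θ, rfl, h⟩
  · exact absurd (matchWt_eq_zero h' w) h

theorem matchWt_bind_ne_zero {ℓ : RTree rk X} {w : X → RTree rk Empty → ℕ}
    {θ : X → RTree rk Empty} (h : ∀ x ∈ ℓ.vars, w x (θ x) ≠ 0) :
    ℓ.matchWt w (ℓ.bind θ) ≠ 0 := by
  rw [matchWt_bind, Finset.prod_ne_zero_iff]
  exact h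

theorem matchWt_congr {ℓ : RTree rk X} {w w' : X → RTree rk Empty → ℕ} {t : RTree rk Empty}
    (h : ∀ θ : X → RTree rk Empty, ℓ.bind θ = t → ∀ x ∈ ℓ.vars, w x (θ x) = w' x (θ x)) :
    ℓ.matchWt w t = ℓ.matchWt w' t := by
  by_cases h' : ∃ θ : X → RTree rk Empty, ℓ.bind θ = t
  · obtain ⟨θ, rfl⟩ := h'
    rw [matchWt_bind, matchWt_bind]
    exact Finset.prod_congr rfl (h θ rfl)
  · rw [matchWt_eq_zero h', matchWt_eq_zero h']

@[simp] theorem matchWt_var (x : X) (w : X → RTree rk Empty → ℕ) (t : RTree rk Empty) :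
    (var x : RTree rk X).matchWt w t = w x t := by
  have := matchWt_bind (var x : RTree rk X) w fun _ => t
  simpa using this

/-- Terms substituted for different variables share no variables, so matches of the pieces glue
together and the product splits into blocks. -/
theorem matchWt_subst (ℓ : RTree rk X) (σ : X → RTree rk Y)
    (hσ : ∀ x ∈ ℓ.vars, ∀ x' ∈ ℓ.vars, ∀ y, y ∈ (σ x).vars → y ∈ (σ x').vars → x = x')
    (w : Y → RTree rk Empty → ℕ) (t : RTree rk Empty) :
    (ℓ.bind σ).matchWt w t = ℓ.matchWt (fun x => (σ x).matchWt w) t := by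
  classical
  by_cases h : ∃ θ : Y → RTree rk Empty, (ℓ.bind σ).bind θ = t
  · obtain ⟨θ, rfl⟩ := h
    rw [matchWt_bind, bind_bind, matchWt_bind]
    have hvars : (ℓ.bind σ).vars = ℓ.vars.biUnion fun x => (σ x).vars := by
      ext y
      simp [mem_vars_bind]
    rw [hvars, Finset.prod_biUnion]
    · exact Finset.prod_congr rfl fun x _ => (matchWt_bind _ _ _).symm
    · intro x hx x' hx' hne
      rw [Function.onFun, Finset.disjoint_left]
      exact fun y hy hy' => hne (hσ x hx x' hx' y hy hy')
  · rw [matchWt_eq_zero h]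
    by_contra hne
    obtain ⟨τ, rfl, hτ⟩ := exists_of_matchWt_ne_zero (Ne.symm hne)
    have hτ' : ∀ x ∈ ℓ.vars, ∃ θ : Y → RTree rk Empty, (σ x).bind θ = τ x :=
      fun x hx => (exists_of_matchWt_ne_zero (hτ x hx)).imp fun _ h => h.1
    have : Nonempty (Y → RTree rk Empty) := ⟨fun _ => ℓ.bind τ⟩
    choose! θ hθ using hτ'
    -- The value on the remaining variables is irrelevant; the matched tree serves because no other
    -- tree need exist.
    refine h ⟨fun y => if hy : ∃ x ∈ ℓ.vars, y ∈ (σ x).vars then θ hy.choose y else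
      ℓ.bind τ, ?_⟩
    rw [bind_bind]
    refine bind_congr fun x hx => ?_
    rw [← hθ x hx]
    refine bind_congr fun y hy => ?_
    have hy' : ∃ x ∈ ℓ.vars, y ∈ (σ x).vars := ⟨x, hx, hy⟩
    rw [dif_pos hy', hσ _ hy'.choose_spec.1 x hx y hy'.choose_spec.2 hy]

end RTree

/-! ### Equality constraints as repeated variables -/

namespace WTGc

open RTree

variable {A : Type u} {rk : A → ℕ} {S : Type v} {Q : Type v} {X Y : Type*}

-- The tree `b` is a skeleton, labeled with states by `h` and with variables by `g`; up to reflexive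
-- pairs, `E` says that two leaves carry the same variable. Satisfying `E` then means being an
-- instance of the nonlinear term, and in each class one leaf contributes the factor `w` while all
-- others contribute 1. Both translations use it: rules to productions with `g` the identity
-- labeling, productions to rules with `h` the identity labeling.
open Classical in
theorem weight_eq_matchWt {G : WTGc rk S} (b : RTree rk Y) (h : List ℕ → Y → S)
    (g : List ℕ → Y → X) (E : Finset (List ℕ × List ℕ)) (w : X → RTree rk Empty → ℕ)
    (hE : ∀ u v, (u, v) ∈ E → ∃ y z, (u, y) ∈ b.leaves ∧ (v, z) ∈ b.leaves ∧ g u y = g v z)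
    (hg : ∀ u y v z, (u, y) ∈ b.leaves → (v, z) ∈ b.leaves → g u y = g v z →
      u = v ∨ (u, v) ∈ E)
    (hw : ∀ u y, (u, y) ∈ b.leaves → ∃ v z, (v, z) ∈ b.leaves ∧ g v z = g u y ∧
      (∀ t, G.weight (var (h v z)) t = w (g u y) t) ∧
      ∀ v' z', (v', z') ∈ b.leaves → g v' z' = g u y → v' ≠ v →
        ∀ t, G.weight (var (h v' z')) t = 1)
    (t : RTree rk Empty) :
    (if Satisfies t E then G.weight (b.mapPos h) t else 0) = (b.mapPos g).matchWt w t := by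
  by_cases ht : ∃ θ : X → RTree rk Empty, (b.mapPos g).bind θ = t
  · obtain ⟨θ, rfl⟩ := ht
    rw [matchWt_bind]
    have hb : (b.mapPos g).bind θ = b.bindPos fun u y => θ (g u y) := mapPos_bindPos _ _ _
    -- The skeleton labeled by states has to be filled by position, since `h` forgets the variable.
    -- The default of `getD` is never reached.
    have hb' : (b.mapPos g).bind θ = (b.mapPos h).bindPos
        fun u _ => (((b.mapPos g).bind θ).subtree? u).getD ((b.mapPos g).bind θ) := by
      rw [mapPos_bindPos]
      conv_lhs => rw [hb]
      refine bindPos_congr fun u y hu => ?_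
      rw [hb, subtree?_bindPos (mem_leaves.1 hu)]
      rfl
    rw [if_pos]
    · rw [hb', weight_bindPos, prod_leaves_mapPos]
      have hv : (b.mapPos g).vars = b.leaves.image fun x => g x.1 x.2 := by
        rw [vars, leaves_eq_image_mapPos, Finset.image_image]
        rfl
      rw [hv]
      rw [← Finset.prod_fiberwise_of_maps_to (g := fun x : List ℕ × Y => g x.1 x.2)
        (t := b.leaves.image fun x => g x.1 x.2) fun x hx => Finset.mem_image_of_mem _ hx]
      refine Finset.prod_congr rfl fun x hx => ?_
      obtain ⟨⟨u, y⟩, hu, rfl⟩ := Finset.mem_image.1 hx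
      obtain ⟨v, z, hv, hvg, hvw, hv'⟩ := hw u y hu
      rw [Finset.prod_eq_single (v, z)]
      · rw [hvw, hb, subtree?_bindPos (mem_leaves.1 hv), Option.getD_some, hvg]
      · rintro ⟨v', z'⟩ h1 h2
        rw [Finset.mem_filter] at h1
        refine hv' v' z' h1.1 h1.2 (fun e => h2 ?_) _
        subst e
        rw [leaf_unique h1.1 hv]
      · intro h1
        exact absurd (Finset.mem_filter.2 ⟨hv, hvg⟩) h1
    · rintro ⟨u, v⟩ he
      obtain ⟨y, z, hu, hv, huv⟩ := hE u v he
      rw [mem_leaves] at hu hv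
      rw [hb]
      exact ⟨_, subtree?_bindPos hu _, by rw [huv]; exact subtree?_bindPos hv _⟩
  · rw [matchWt_eq_zero ht]
    by_contra hne
    rw [ite_eq_right_iff, Classical.not_imp] at hne
    obtain ⟨hsat, hne⟩ := hne
    obtain ⟨ρ, rfl⟩ := exists_eq_bindPos_of_weight_ne_zero hne
    rw [mapPos_bindPos] at hsat ht
    -- Any leaf labeled `x` may supply the value, because the constraints force all of them to carry
    -- equal subtrees.
    refine ht ⟨fun x => if hx : ∃ e ∈ b.leaves, g e.1 e.2 = x then
      ρ hx.choose.1 (h hx.choose.1 hx.choose.2) else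
      b.bindPos fun w z => ρ w (h w z), ?_⟩
    refine (mapPos_bindPos _ _ _).trans (bindPos_congr fun u y hu => ?_)
    have hx : ∃ e ∈ b.leaves, g e.1 e.2 = g u y := ⟨(u, y), hu, rfl⟩
    rw [dif_pos hx]
    obtain ⟨he, heq⟩ := hx.choose_spec
    generalize hx.choose = e at he heq
    obtain ⟨v, z⟩ := e
    rcases hg u y v z hu he heq.symm with rfl | huv
    · rw [leaf_unique hu he]
    · obtain ⟨s, h1, h2⟩ := hsat _ huv
      rw [subtree?_bindPos (mem_leaves.1 hu)] at h1
      rw [subtree?_bindPos (mem_leaves.1 he)] at h2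
      exact Option.some.inj (h2.trans h1.symm)

/-- At each node only the sink production of its symbol applies, with weight 1 and no constraint. -/
theorem IsWTGh.weight_sink {G : WTGc rk (Option Q)} (hG : G.IsWTGh) (t : RTree rk Empty) :
    G.weight (var none) t = 1 := by
  classical
  induction t with
  | var z => exact z.elim
  | node a ts ih =>
    rw [weight_var, Finset.sum_eq_single (sinkProduction Q a)]
    · rw [if_pos ⟨rfl, by simp [Satisfies, sinkProduction]⟩, hG.wt_sink, one_mul]
      simp only [sinkProduction, weight_node, ih, Finset.prod_const_one]
    · intro p hp hne
      split_ifs with hq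
      · obtain ⟨b, rfl⟩ := hG.eq_sink p hp hq.1
        have hba : b ≠ a := by rintro rfl; exact hne rfl
        simp only [sinkProduction, weight_node_of_ne hba, mul_zero]
      · rfl
    · intro h
      exact absurd (hG.sink_mem a) h

end WTGc

/-! ### Rules with nonlinear left-hand sides and the grammars they define -/

/-- A weighted rule whose left-hand side is a possibly nonlinear term.  A variable `x` carries the
state `x.2`, and repeated occurrences of a variable stand for equality constraints. -/
structure HomRule {A : Type u} (rk : A → ℕ) (Q : Type v) where
  lhs : RTree rk (List ℕ × Q)
  target : Q
  wt : ℕ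
  lhs_ne_var : ∀ x, lhs ≠ RTree.var x

namespace HomRule

open RTree

variable {A : Type u} {rk : A → ℕ} {Q : Type v} {ι : Type w}

open Classical in
/-- The production with constraints that represents a rule: the least occurrence of a variable is
labeled by its state, all others by the sink state. -/
noncomputable def toProduction (r : HomRule rk Q) : Production rk (Option Q) where
  lhs := r.lhs.mapPos fun u x =>
    if ∃ v, PosLT v u ∧ (v, x) ∈ r.lhs.leaves then none else some x.2
  target := some r.target
  constraints := ((r.lhs.leaves ×ˢ r.lhs.leaves).filter fun e => e.1.2 = e.2.2).image
    fun e => (e.1.1, e.2.1)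
  lhs_ne_var := mapPos_ne_var r.lhs_ne_var _

theorem mem_constraints {r : HomRule rk Q} {u v : List ℕ} :
    (u, v) ∈ r.toProduction.constraints ↔
      ∃ x, (u, x) ∈ r.lhs.leaves ∧ (v, x) ∈ r.lhs.leaves := by
  classical
  simp only [toProduction, Finset.mem_image, Finset.mem_filter, Finset.mem_product,
    Prod.mk.injEq]
  constructor
  · rintro ⟨⟨⟨_, x⟩, ⟨_, y⟩⟩, ⟨⟨h, h'⟩, hxy⟩, rfl, rfl⟩
    exact ⟨x, h, by rw [show x = y from hxy]; exact h'⟩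
  · rintro ⟨x, h, h'⟩
    exact ⟨((u, x), (v, x)), ⟨⟨h, h'⟩, rfl⟩, rfl, rfl⟩

open Classical in
theorem subtree?_toProduction {r : HomRule rk Q} {u : List ℕ} {x : List ℕ × Q}
    (h : (u, x) ∈ r.lhs.leaves) : r.toProduction.lhs.subtree? u =
      some (var (if ∃ v, PosLT v u ∧ (v, x) ∈ r.lhs.leaves then none else some x.2)) := by
  rw [mem_leaves] at h
  exact subtree?_bindPos h _

theorem exists_least_leaf {r : HomRule rk Q} {x : List ℕ × Q} (hx : x ∈ r.lhs.vars) :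
    ∃ u, (u, x) ∈ r.lhs.leaves ∧ ∀ v, (v, x) ∈ r.lhs.leaves → ¬ PosLT v u := by
  refine exists_posLT_minimal (s := {u | (u, x) ∈ r.lhs.leaves}) ?_ (mem_vars.1 hx)
  refine (r.lhs.leaves.image Prod.fst).finite_toSet.subset fun u hu => ?_
  exact Finset.mem_coe.2 (Finset.mem_image.2 ⟨(u, x), hu, rfl⟩)

variable [Fintype ι]

open Classical in
/-- The functions `f q` are computed by the rules `r`. -/
def IsSolution (r : ι → HomRule rk Q) (f : Q → RTree rk Empty → ℕ) : Prop :=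
  ∀ q t, f q t = ∑ i, if (r i).target = q then
    (r i).wt * (r i).lhs.matchWt (fun x => f x.2) t else 0

/-- A left-hand side is never a bare variable, so the recursion only calls strictly lower trees. -/
theorem IsSolution.unique {r : ι → HomRule rk Q} {f g : Q → RTree rk Empty → ℕ}
    (hf : IsSolution r f) (hg : IsSolution r g) : f = g := by
  have key : ∀ n q t, t.height < n → f q t = g q t := by
    intro n
    induction n with
    | zero => intro q t h; omega
    | succ n ih =>
      intro q t h
      rw [hf, hg]
      refine Finset.sum_congr rfl fun i _ => ?_
      split_ifs with hi
      · congr 1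
        refine matchWt_congr ?_
        rintro θ rfl x hx
        have := height_lt_height_bind (r i).lhs_ne_var (θ := θ) hx
        exact ih _ _ (by omega)
      · rfl
  funext q t
  exact key _ q t (Nat.lt_succ_self _)

variable [Fintype A]

open Classical in
/-- The grammar with constraints that represents a finite family of rules. -/
noncomputable def toWTGc (r : ι → HomRule rk Q) (F : Q → ℕ) : WTGc rk (Option Q) where
  F o := o.elim 0 F
  P := Finset.univ.image (WTGc.sinkProduction Q) ∪ Finset.univ.image fun i => (r i).toProduction
  wt p := if p.target = none then 1 else
    ∑ i, if (r i).toProduction = p then (r i).wt else 0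

theorem mem_toWTGc {r : ι → HomRule rk Q} {F : Q → ℕ} {p : Production rk (Option Q)} :
    p ∈ (toWTGc r F).P ↔
      (∃ a, WTGc.sinkProduction Q a = p) ∨ ∃ i, (r i).toProduction = p := by
  classical
  simp [toWTGc]

theorem isWTGh_toWTGc (r : ι → HomRule rk Q) (F : Q → ℕ) : (toWTGc r F).IsWTGh where
  F_sink := rfl
  sink_mem a := mem_toWTGc.2 (Or.inl ⟨a, rfl⟩)
  wt_sink a := by simp [toWTGc, WTGc.sinkProduction]
  eq_sink p hp h := by
    rcases mem_toWTGc.1 hp with ⟨a, rfl⟩ | ⟨i, rfl⟩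
    · exact ⟨a, rfl⟩
    · cases h
  state_pos p hp u v h := by
    rcases mem_toWTGc.1 hp with ⟨a, rfl⟩ | ⟨i, rfl⟩
    · simp [WTGc.sinkProduction] at h
    · obtain ⟨x, hu, hv⟩ := mem_constraints.1 h
      exact ⟨⟨_, subtree?_toProduction hu⟩, ⟨_, subtree?_toProduction hv⟩⟩
  refl p hp u v h := by
    rcases mem_toWTGc.1 hp with ⟨a, rfl⟩ | ⟨i, rfl⟩
    · simp [WTGc.sinkProduction] at h
    · obtain ⟨x, hu, hv⟩ := mem_constraints.1 h
      exact mem_constraints.2 ⟨x, hu, hu⟩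
  symm p hp u v h := by
    rcases mem_toWTGc.1 hp with ⟨a, rfl⟩ | ⟨i, rfl⟩
    · simp [WTGc.sinkProduction] at h
    · obtain ⟨x, hu, hv⟩ := mem_constraints.1 h
      exact mem_constraints.2 ⟨x, hv, hu⟩
  trans p hp u v w h h' := by
    rcases mem_toWTGc.1 hp with ⟨a, rfl⟩ | ⟨i, rfl⟩
    · simp [WTGc.sinkProduction] at h
    · obtain ⟨x, hu, hv⟩ := mem_constraints.1 h
      obtain ⟨y, hv', hw⟩ := mem_constraints.1 h'
      obtain rfl := leaf_unique hv hv'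
      exact mem_constraints.2 ⟨x, hu, hw⟩
  guarded p hp w h := by
    rcases mem_toWTGc.1 hp with ⟨a, rfl⟩ | ⟨i, rfl⟩
    · simp [WTGc.sinkProduction] at h
    · obtain ⟨x, hw, -⟩ := mem_constraints.1 h
      rw [subtree?_toProduction hw]
      simp only [Option.some.injEq, var.injEq, ite_eq_left_iff, reduceCtorEq, imp_false,
        not_not]
      constructor
      · rintro ⟨v, hv, hvx⟩
        exact ⟨v, mem_constraints.2 ⟨x, hvx, hw⟩, hv⟩
      · rintro ⟨v, hv, hv'⟩
        obtain ⟨y, hvy, hwy⟩ := mem_constraints.1 hv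
        obtain rfl := leaf_unique hw hwy
        exact ⟨v, hv', hvy⟩

open Classical in
theorem weight_toProduction (r : ι → HomRule rk Q) (F : Q → ℕ) (i : ι) (t : RTree rk Empty) :
    (if Satisfies t (r i).toProduction.constraints then
      (toWTGc r F).weight (r i).toProduction.lhs t else 0) =
      (r i).lhs.matchWt (fun x => (toWTGc r F).weight (var (some x.2))) t := by
  have := WTGc.weight_eq_matchWt (G := toWTGc r F) (r i).lhs
    (fun u x => if ∃ v, PosLT v u ∧ (v, x) ∈ (r i).lhs.leaves then none else some x.2)
    (fun _ x => x) (r i).toProduction.constraints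
    (fun x => (toWTGc r F).weight (var (some x.2))) ?_ ?_ ?_ t
  · rw [mapPos_id] at this
    exact this
  · intro u v h
    obtain ⟨x, hu, hv⟩ := mem_constraints.1 h
    exact ⟨x, x, hu, hv, rfl⟩
  · rintro u y v z hu hv rfl
    exact Or.inr (mem_constraints.2 ⟨y, hu, hv⟩)
  · intro u x hu
    obtain ⟨v, hv, hmin⟩ := exists_least_leaf (mem_vars.2 ⟨u, hu⟩)
    refine ⟨v, x, hv, rfl, fun t => ?_, ?_⟩
    · rw [if_neg]
      rintro ⟨v', h, h'⟩
      exact hmin v' h' h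
    · rintro v' _ hv' rfl hne t
      rw [if_pos]
      · exact (isWTGh_toWTGc r F).weight_sink t
      · rcases posLT_trichotomy v v' with h | h | h
        · exact ⟨v, h, hv⟩
        · exact absurd h.symm hne
        · exact absurd h (hmin v' hv')

/-- Distinct rules may yield the same production, whose weight is then the sum of theirs. The sum
over productions is therefore regrouped as a sum over rules. -/
theorem isSolution_weight (r : ι → HomRule rk Q) (F : Q → ℕ) :
    IsSolution r fun q => (toWTGc r F).weight (var (some q)) := by
  classical
  intro q t
  have h (p : Production rk (Option Q)) :
      (if p.target = some q ∧ Satisfies t p.constraints then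
        (toWTGc r F).wt p * (toWTGc r F).weight p.lhs t else 0) =
      ∑ i, if (r i).toProduction = p then
        (if (r i).target = q then (r i).wt * (r i).lhs.matchWt
          (fun x => (toWTGc r F).weight (var (some x.2))) t else 0) else 0 := by
    by_cases hp : p.target = some q ∧ Satisfies t p.constraints
    · rw [if_pos hp]
      have : (toWTGc r F).wt p = ∑ i, if (r i).toProduction = p then (r i).wt else 0 := by
        simp only [toWTGc]
        rw [if_neg (by simp [hp.1])]
      rw [this, Finset.sum_mul]
      refine Finset.sum_congr rfl fun i _ => ?_
      split_ifs with h1 h2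
      · rw [← weight_toProduction r F i t, h1, if_pos hp.2]
      · subst h1
        exact absurd (Option.some.inj hp.1) h2
      · simp
    · rw [if_neg hp]
      symm
      refine Finset.sum_eq_zero fun i _ => ?_
      split_ifs with h1 h2 <;> try rfl
      rw [← weight_toProduction r F i t, h1, if_neg, mul_zero]
      intro hsat
      exact hp ⟨by rw [← h1, ← h2]; rfl, hsat⟩
  change (toWTGc r F).weight (var (some q)) t = _
  rw [WTGc.weight_var]
  refine (Finset.sum_congr rfl fun p _ => Eq.trans (by congr) (h p)).trans ?_
  rw [Finset.sum_comm]
  refine Finset.sum_congr rfl fun i _ => ?_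
  rw [Finset.sum_ite_eq, if_pos (mem_toWTGc.2 (Or.inr ⟨i, rfl⟩))]

/-- The weight of the derivations of `t` to `q`. -/
noncomputable def value (r : ι → HomRule rk Q) (q : Q) : RTree rk Empty → ℕ :=
  (toWTGc r fun _ => 0).weight (var (some q))

theorem isSolution_value (r : ι → HomRule rk Q) : IsSolution r (value r) :=
  isSolution_weight r _

theorem IsSolution.eq_value {r : ι → HomRule rk Q} {f : Q → RTree rk Empty → ℕ}
    (hf : IsSolution r f) (q : Q) : f q = value r q :=
  congrFun (hf.unique (isSolution_value r)) q

theorem weight_toWTGc (r : ι → HomRule rk Q) (F : Q → ℕ) (q : Q) :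
    (toWTGc r F).weight (var (some q)) = value r q :=
  (isSolution_weight r F).eq_value q

theorem sem_toWTGc [Fintype Q] (r : ι → HomRule rk Q) (F : Q → ℕ) (t : RTree rk Empty) :
    (toWTGc r F).sem t = ∑ q, F q * value r q t := by
  rw [WTGc.sem_eq, Fintype.sum_option]
  simp only [weight_toWTGc]
  simp [toWTGc]

end HomRule

/-! ### Trimming, and the rules of a given grammar -/

namespace WTGc

open RTree

variable {A : Type u} {rk : A → ℕ} {S : Type v} {Q : Type v}

theorem weight_ne_zero_iff {G : WTGc rk S} {ξ : RTree rk S} {t : RTree rk Empty} :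
    G.weight ξ t ≠ 0 ↔ ∃ d ∈ G.derivTo ξ t, G.derivWt d ≠ 0 := by
  simp [weight]

theorem derives_iff_of_subset {G G' : WTGc rk S} (h : G'.P ⊆ G.P) {t : RTree rk Empty}
    {ξ ζ : RTree rk S} {d : List (Production rk S × List ℕ)} :
    G'.Derives t ξ d ζ ↔ G.Derives t ξ d ζ ∧ ∀ x ∈ d, x.1 ∈ G'.P := by
  induction d generalizing ξ with
  | nil => simp [derives_nil_iff]
  | cons x d ih =>
    obtain ⟨p, w⟩ := x
    simp only [derives_cons_iff, ih, List.mem_cons, forall_eq_or_imp]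
    constructor
    · rintro ⟨h1, h2, h3, h4, h5⟩
      exact ⟨⟨h h1, h2, h3, h4⟩, h1, h5⟩
    · rintro ⟨⟨h1, h2, h3, h4⟩, h5, h6⟩
      exact ⟨h5, h2, h3, h4, h6⟩

open Classical in
/-- Remove all productions that are neither sink productions nor used. -/
noncomputable def trim (G : WTGc rk (Option Q)) : WTGc rk (Option Q) where
  F := G.F
  P := G.P.filter fun p => p.target = none ∨ G.Used p
  wt := G.wt

theorem mem_trim {G : WTGc rk (Option Q)} {p : Production rk (Option Q)} :
    p ∈ G.trim.P ↔ p ∈ G.P ∧ (p.target = none ∨ G.Used p) := by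
  simp [trim]

theorem trim_subset (G : WTGc rk (Option Q)) : G.trim.P ⊆ G.P :=
  fun _ h => (mem_trim.1 h).1

/-- An accepting derivation of nonzero weight itself witnesses that each of its productions is used,
so it survives trimming. Hence one trimming pass is enough. -/
theorem mem_derivations_trim {G : WTGc rk (Option Q)} {q : Option Q} {t : RTree rk Empty}
    {d : List (Production rk (Option Q) × List ℕ)} (hd : d ∈ G.derivations q t)
    (hne : G.F q * G.derivWt d ≠ 0) : d ∈ G.trim.derivations q t := by
  refine ⟨(derives_iff_of_subset G.trim_subset).2 ⟨hd.1, fun x hx => ?_⟩, hd.2⟩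
  exact mem_trim.2 ⟨(hd.1.mem x hx).1, Or.inr ⟨t, q, d, hd, hne, x.2, hx⟩⟩

theorem isTrim_trim (G : WTGc rk (Option Q)) : G.trim.IsTrim := by
  intro p hp hpt
  obtain ⟨t, q, d, hd, hne, h⟩ := (mem_trim.1 hp).2.resolve_left hpt
  exact ⟨t, q, d, mem_derivations_trim hd hne, hne, h⟩

theorem IsWTGh.trim {G : WTGc rk (Option Q)} (hG : G.IsWTGh) : G.trim.IsWTGh where
  F_sink := hG.F_sink
  sink_mem a := mem_trim.2 ⟨hG.sink_mem a, Or.inl rfl⟩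
  wt_sink := hG.wt_sink
  eq_sink p hp := hG.eq_sink p (mem_trim.1 hp).1
  state_pos p hp := hG.state_pos p (mem_trim.1 hp).1
  refl p hp := hG.refl p (mem_trim.1 hp).1
  symm p hp := hG.symm p (mem_trim.1 hp).1
  trans p hp := hG.trans p (mem_trim.1 hp).1
  guarded p hp := hG.guarded p (mem_trim.1 hp).1

theorem sem_trim [Fintype Q] (G : WTGc rk (Option Q)) (t : RTree rk Empty) :
    G.trim.sem t = G.sem t := by
  rw [sem_eq, sem_eq]
  refine Finset.sum_congr rfl fun q _ => ?_
  rw [weight, weight, Finset.mul_sum, Finset.mul_sum]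
  refine Finset.sum_subset (fun d hd => ?_) fun d hd hd' => ?_
  · rw [Set.Finite.mem_toFinset] at hd ⊢
    exact ⟨((derives_iff_of_subset G.trim_subset).1 hd.1).1, hd.2⟩
  · rw [Set.Finite.mem_toFinset] at hd hd'
    by_contra hne
    exact hd' (mem_derivations_trim hd hne)

/-- A production of weight 0 would annihilate every derivation using it and so could not be used.
Thus nonempty derivation sets and nonzero weights coincide in a trim grammar. -/
theorem IsTrim.derivWt_ne_zero {G : WTGc rk (Option Q)} (hG : G.IsWTGh) (htrim : G.IsTrim)
    {ξ : RTree rk (Option Q)} {t : RTree rk Empty}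
    {d : List (Production rk (Option Q) × List ℕ)} (hd : d ∈ G.derivTo ξ t) :
    G.derivWt d ≠ 0 := by
  have hwt : ∀ p ∈ G.P, G.wt p ≠ 0 := by
    intro p hp
    by_cases hpt : p.target = none
    · obtain ⟨a, rfl⟩ := hG.eq_sink p hp hpt
      simp [hG.wt_sink]
    · obtain ⟨t, q, d, -, hne, w, hw⟩ := htrim p hp hpt
      intro h0
      apply hne
      rw [derivWt, List.prod_eq_zero, mul_zero]
      exact List.mem_map.2 ⟨(p, w), hw, h0⟩
  rw [derivWt]
  intro h0
  rw [List.prod_eq_zero_iff, List.mem_map] at h0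
  obtain ⟨x, hx, h0⟩ := h0
  exact hwt _ (hd.1.mem x hx).1 h0

/-- Project repeatedly to the child containing the step until a state leaf is reached; projection
shortens derivations, and the weight of each projection is a factor of the original weight. -/
theorem exists_leaf_derivation {G : WTGc rk S} {ξ : RTree rk S} {t : RTree rk Empty}
    {d : List (Production rk S × List ℕ)} (hd : d ∈ G.derivTo ξ t) (hne : G.derivWt d ≠ 0)
    {p : Production rk S} {w : List ℕ} (hp : (p, w) ∈ d) :
    ∃ u s t' e w', (u, s) ∈ ξ.leaves ∧ e ∈ G.derivTo (var s) t' ∧ G.derivWt e ≠ 0 ∧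
      (p, w') ∈ e ∧ e.length ≤ d.length := by
  induction ξ generalizing t d w with
  | var q => exact ⟨[], q, t, d, w, by simp [leaves], hd, hne, hp, le_rfl⟩
  | node a ξs ih =>
    cases t with
    | var z => exact z.elim
    | node b ts =>
      by_cases hab : a = b
      · subst hab
        rw [mem_derivTo_node] at hd
        obtain ⟨j, x, rfl⟩ := hd.1 _ hp
        rw [derivWt_eq_prod hd.1, Finset.prod_ne_zero_iff] at hne
        obtain ⟨u, s, t', e, w', hu, he, h1, h2, h3⟩ :=
          ih j (hd.2.2 j) (hne j (Finset.mem_univ j)) (mem_proj.2 hp)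
        refine ⟨j.1 :: u, s, t', e, w', ?_, he, h1, h2, h3.trans (List.length_filterMap_le _ _)⟩
        rw [mem_leaves, subtree?_node_cons]
        exact mem_leaves.1 hu
      · rw [derivTo_node_of_ne hab] at hd
        exact absurd hd (Set.notMem_empty _)

open Classical in
/-- The variable that represents the leaf of the left-hand side of `p` at position `u` with state
`s`: a leaf whose class is guarded by another leaf is represented by the latter. -/
noncomputable def guardVar (p : Production rk (Option Q)) (u : List ℕ) (s : Option Q) :
    List ℕ × Option Q :=
  if h : s = none ∧ ∃ x : List ℕ × Q, (x.1, u) ∈ p.constraints ∧ (x.1, some x.2) ∈ p.lhs.leaves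
  then (h.2.choose.1, some h.2.choose.2) else (u, s)

theorem guardVar_some (p : Production rk (Option Q)) (u : List ℕ) (q : Q) :
    guardVar p u (some q) = (u, some q) := by
  simp [guardVar]

theorem guardVar_cases (p : Production rk (Option Q)) (u : List ℕ) (s : Option Q) :
    (guardVar p u s = (u, s) ∧ (s = none → ∀ v q, (v, u) ∈ p.constraints →
      (v, some q) ∉ p.lhs.leaves)) ∨
      s = none ∧ ∃ v q, (v, u) ∈ p.constraints ∧ (v, some q) ∈ p.lhs.leaves ∧
        guardVar p u s = (v, some q) := by
  by_cases h : s = none ∧ ∃ x : List ℕ × Q, (x.1, u) ∈ p.constraints ∧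
      (x.1, some x.2) ∈ p.lhs.leaves
  · right
    refine ⟨h.1, _, _, h.2.choose_spec.1, h.2.choose_spec.2, ?_⟩
    rw [guardVar, dif_pos h]
  · left
    rw [guardVar, dif_neg h]
    exact ⟨rfl, fun hs v q h1 h2 => h ⟨hs, ⟨(v, q), h1, h2⟩⟩⟩

namespace IsWTGh

variable {G : WTGc rk (Option Q)} (hG : G.IsWTGh) {p : Production rk (Option Q)} (hp : p ∈ G.P)
include hG hp

/-- By `guarded`, a constrained position with a smaller equivalent one carries ⊥, so two proper
states in one class sit at the same position. -/
theorem guard_unique {u v : List ℕ} {q q' : Q} (h : (u, v) ∈ p.constraints)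
    (hu : (u, some q) ∈ p.lhs.leaves) (hv : (v, some q') ∈ p.lhs.leaves) : u = v := by
  have key : ∀ {u v : List ℕ} {q : Q}, (u, v) ∈ p.constraints →
      (v, some q) ∈ p.lhs.leaves → ¬ PosLT u v := by
    intro u v q h hv hlt
    have hvv := hG.refl p hp v u (hG.symm p hp u v h)
    have := (hG.guarded p hp v hvv).2 ⟨u, h, hlt⟩
    rw [mem_leaves] at hv
    simp [hv] at this
  rcases posLT_trichotomy u v with h' | h' | h'
  · exact absurd h' (key h hv)
  · exact h'
  · exact absurd h' (key (hG.symm p hp u v h) hu)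

theorem exists_guard {u : List ℕ} (h : (u, u) ∈ p.constraints) :
    ∃ v q, (v, u) ∈ p.constraints ∧ (v, some q) ∈ p.lhs.leaves := by
  classical
  have hfin : {v | (v, u) ∈ p.constraints}.Finite :=
    (p.constraints.image Prod.fst).finite_toSet.subset fun v hv =>
      Finset.mem_coe.2 (Finset.mem_image.2 ⟨(v, u), hv, rfl⟩)
  obtain ⟨v, hv, hmin⟩ := exists_posLT_minimal hfin ⟨u, h⟩
  obtain ⟨⟨s, hs⟩, -⟩ := hG.state_pos p hp v u hv
  cases s with
  | some q => exact ⟨v, q, hv, mem_leaves.2 hs⟩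
  | none =>
    obtain ⟨v', hv', hlt⟩ := (hG.guarded p hp v (hG.refl p hp v u hv)).1 hs
    exact absurd hlt (hmin v' (hG.trans p hp v' v u hv' hv))

theorem guardVar_of_mem {u : List ℕ} {s : Option Q} (h : (u, u) ∈ p.constraints)
    (hu : (u, s) ∈ p.lhs.leaves) :
    ∃ v q, (v, u) ∈ p.constraints ∧ (v, some q) ∈ p.lhs.leaves ∧
        guardVar p u s = (v, some q) := by
  rcases guardVar_cases p u s with ⟨h1, h2⟩ | ⟨-, h⟩
  · cases s with
    | some q => exact ⟨u, q, h, hu, h1⟩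
    | none =>
      obtain ⟨v, q, hv, hq⟩ := hG.exists_guard hp h
      exact absurd hq (h2 rfl v q hv)
  · exact h

open Classical in
theorem weight_eq_matchWt (t : RTree rk Empty) :
    (if Satisfies t p.constraints then G.weight p.lhs t else 0) =
      (p.lhs.mapPos (guardVar p)).matchWt (fun x => G.weight (var x.2)) t := by
  have := WTGc.weight_eq_matchWt (G := G) p.lhs (fun _ s => s) (guardVar p) p.constraints
    (fun x => G.weight (var x.2)) ?_ ?_ ?_ t
  · rwa [mapPos_id] at this
  · intro u v huv
    have huu := hG.refl p hp u v huv
    have hvv := hG.refl p hp v u (hG.symm p hp u v huv)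
    obtain ⟨⟨y, hy⟩, ⟨z, hz⟩⟩ := hG.state_pos p hp u v huv
    rw [← mem_leaves] at hy hz
    refine ⟨y, z, hy, hz, ?_⟩
    obtain ⟨a, qa, ha, hqa, ea⟩ := hG.guardVar_of_mem hp huu hy
    obtain ⟨b, qb, hb, hqb, eb⟩ := hG.guardVar_of_mem hp hvv hz
    have hab : (a, b) ∈ p.constraints :=
      hG.trans p hp _ _ _ (hG.trans p hp _ _ _ ha huv) (hG.symm p hp _ _ hb)
    obtain rfl := hG.guard_unique hp hab hqa hqb
    rw [ea, eb, leaf_unique hqa hqb]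
  · intro u y v z hu hv e
    have key : ∀ u y, (guardVar p u y).1 = u ∨ ((guardVar p u y).1, u) ∈ p.constraints := by
      intro u y
      rcases guardVar_cases p u y with ⟨h, -⟩ | ⟨-, v, q, h, -, h'⟩
      · left; rw [h]
      · right; rw [h']; exact h
    rcases key u y with h | h <;> rcases key v z with h' | h' <;> rw [e] at h
    · exact Or.inl (h.symm.trans h')
    · rw [h] at h'; exact Or.inr h'
    · rw [h'] at h; exact Or.inr (hG.symm p hp _ _ h)
    · exact Or.inr (hG.trans p hp _ _ _ (hG.symm p hp _ _ h) h')
  · intro u y hu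
    obtain ⟨v, z, hv, e, hself⟩ : ∃ v z, (v, z) ∈ p.lhs.leaves ∧ guardVar p u y = (v, z) ∧
        guardVar p v z = (v, z) := by
      rcases guardVar_cases p u y with ⟨h, -⟩ | ⟨-, v, q, h, hv, h'⟩
      · exact ⟨u, y, hu, h, h⟩
      · exact ⟨v, some q, hv, h', guardVar_some p v q⟩
    refine ⟨v, z, hv, hself.trans e.symm, fun t => by rw [e], fun v' z' hv' e' hne t => ?_⟩
    rcases guardVar_cases p v' z' with ⟨h, -⟩ | ⟨rfl, -⟩
    · rw [e, h] at e'
      exact absurd (congrArg Prod.fst e') hne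
    · exact hG.weight_sink t

end IsWTGh

/-- The productions of `G` as rules.  The sink state of `G` becomes an ordinary state. -/
noncomputable def toHomRule (G : WTGc rk (Option Q)) (p : {p // p ∈ G.P}) :
    HomRule rk (Option Q) where
  lhs := p.1.lhs.mapPos (guardVar p.1)
  target := p.1.target
  wt := G.wt p.1
  lhs_ne_var := mapPos_ne_var p.1.lhs_ne_var _

/-- Both sides solve the same recursive system, the left one because every production matches like
its nonlinear term. -/
theorem IsWTGh.weight_var_eq_value [Fintype A] {G : WTGc rk (Option Q)} (hG : G.IsWTGh)
    (q : Option Q) : G.weight (var q) = HomRule.value G.toHomRule q := by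
  classical
  refine HomRule.IsSolution.eq_value (f := fun q => G.weight (var q)) (fun q t => ?_) q
  change G.weight (var q) t = _
  rw [weight_var, ← Finset.sum_coe_sort]
  refine Finset.sum_congr rfl fun p _ => ?_
  rw [show (G.toHomRule p).lhs = p.1.lhs.mapPos (guardVar p.1) from rfl,
    ← hG.weight_eq_matchWt p.2 t, show (G.toHomRule p).target = p.1.target from rfl,
    show (G.toHomRule p).wt = G.wt p.1 from rfl]
  by_cases h1 : p.1.target = q <;> by_cases h2 : Satisfies t p.1.constraints
  · rw [if_pos ⟨h1, h2⟩, if_pos h1, if_pos h2]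
  · rw [if_neg (fun h => h2 h.2), if_pos h1, if_neg h2, mul_zero]
  · rw [if_neg (fun h => h1 h.1), if_neg h1]
  · rw [if_neg (fun h => h1 h.1), if_neg h1]

end WTGc

/-! ### Rules occurring in derivations of nonzero weight -/

namespace HomRule

variable {A : Type u} {rk : A → ℕ} {Q : Type v} {ι : Type w} [Fintype A] [Fintype ι]

/-- The rule `i` can be used in derivations of nonzero weight to the state `q`. -/
inductive Occurs (r : ι → HomRule rk Q) (i : ι) : Q → Prop
  | root (t : RTree rk Empty) (hwt : (r i).wt ≠ 0)
      (h : (r i).lhs.matchWt (fun x => value r x.2) t ≠ 0) : Occurs r i (r i).target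
  | step (j : ι) (t : RTree rk Empty) (x : List ℕ × Q) (hwt : (r j).wt ≠ 0)
      (h : (r j).lhs.matchWt (fun x => value r x.2) t ≠ 0) (hx : x ∈ (r j).lhs.vars)
      (hi : Occurs r i x.2) : Occurs r i (r j).target

end HomRule

namespace WTGc

open RTree

variable {A : Type u} {rk : A → ℕ} {Q : Type v} [Fintype A]

/-- Induction on the length of the derivation: either `p` is the root step, or it lies in the
derivation at some leaf of the root production's left-hand side, which is shorter by at least that
step. -/
theorem IsWTGh.occurs_of_mem {G : WTGc rk (Option Q)} (hG : G.IsWTGh) {q : Option Q}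
    {t : RTree rk Empty} {d : List (Production rk (Option Q) × List ℕ)}
    (hd : d ∈ G.derivTo (var q) t) (hne : G.derivWt d ≠ 0) {p : Production rk (Option Q)}
    {w : List ℕ} (hpd : (p, w) ∈ d) (hp : p ∈ G.P) (hpt : p.target ≠ none) :
    q ≠ none ∧ HomRule.Occurs G.toHomRule ⟨p, hp⟩ q := by
  classical
  induction hn : d.length using Nat.strong_induction_on generalizing q t d w with
  | _ n ih =>
    subst hn
    obtain ⟨p', d', rfl, hp', rfl, hsat, hd'⟩ := mem_derivTo_var.1 hd
    have hne' : G.derivWt d' * G.wt p' ≠ 0 := by simpa [derivWt] using hne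
    have hm : (G.toHomRule ⟨p', hp'⟩).lhs.matchWt
        (fun x => HomRule.value G.toHomRule x.2) t ≠ 0 := by
      have := hG.weight_eq_matchWt hp' t
      rw [if_pos hsat] at this
      simp only [hG.weight_var_eq_value] at this
      change (p'.lhs.mapPos (guardVar p')).matchWt _ t ≠ 0
      rw [← this, weight_ne_zero_iff]
      exact ⟨d', hd', left_ne_zero_of_mul hne'⟩
    rcases List.mem_append.1 hpd with h | h
    · obtain ⟨u, s, t', e, w', hu, he, h1, h2, h3⟩ :=
        exists_leaf_derivation hd' (left_ne_zero_of_mul hne') h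
      obtain ⟨hs, hocc⟩ := ih e.length (by simp; omega) he h1 h2 rfl
      -- A sink production has only ⊥-leaves, which `hs` excludes; a leaf with a proper state is its
      -- own variable under `guardVar`.
      refine ⟨fun ht => ?_, ?_⟩
      · obtain ⟨a, rfl⟩ := hG.eq_sink p' hp' ht
        rw [mem_leaves, sinkProduction] at hu
        cases u with
        | nil => simp [subtree?] at hu
        | cons i u =>
          by_cases hi : i < rk a
          · cases u with
            | nil => simp [subtree?, hi] at hu; exact hs hu.symm
            | cons => simp [subtree?, hi] at hu
          · simp [subtree?, hi] at hu
      · obtain ⟨s, rfl⟩ := Option.ne_none_iff_exists'.1 hs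
        refine HomRule.Occurs.step (r := G.toHomRule) ⟨p', hp'⟩ t (u, some s)
          (right_ne_zero_of_mul hne') hm ?_ hocc
        refine mem_vars.2 ⟨u, leaves_mapPos_iff.2 ⟨some s, hu, guardVar_some p' u s⟩⟩
    · simp only [List.mem_singleton, Prod.mk.injEq] at h
      obtain ⟨rfl, -⟩ := h
      exact ⟨hpt, HomRule.Occurs.root (r := G.toHomRule) t (right_ne_zero_of_mul hne') hm⟩

end WTGc

/-! ### Height bound for finite languages; renaming and sums -/

namespace RTree

variable {A : Type u} {rk : A → ℕ} {X Y : Type*}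

theorem matchWt_bind_update_ne_zero [DecidableEq X] {ℓ : RTree rk X} {w : X → RTree rk Empty → ℕ}
    {θ : X → RTree rk Empty} (h : ∀ x ∈ ℓ.vars, w x (θ x) ≠ 0) {x : X} {s : RTree rk Empty}
    (hs : w x s ≠ 0) : ℓ.matchWt w (ℓ.bind (Function.update θ x s)) ≠ 0 := by
  refine matchWt_bind_ne_zero fun y hy => ?_
  by_cases hyx : y = x
  · subst hyx; simpa using hs
  · simpa [hyx] using h y hy

/-- The product over variables has exactly one factor for `x`, even if `x` occurs several times, so
it is linear in the function at `x`. -/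
theorem matchWt_update_add [DecidableEq X] {ℓ : RTree rk X} {x : X} (hx : x ∈ ℓ.vars)
    (w : X → RTree rk Empty → ℕ) (k : ℕ) (f g : RTree rk Empty → ℕ) (t : RTree rk Empty) :
    ℓ.matchWt (Function.update w x fun t => k * f t + g t) t =
      k * ℓ.matchWt (Function.update w x f) t + ℓ.matchWt (Function.update w x g) t := by
  by_cases h : ∃ θ : X → RTree rk Empty, ℓ.bind θ = t
  · obtain ⟨θ, rfl⟩ := h
    have key (f : RTree rk Empty → ℕ) : ∏ y ∈ ℓ.vars, Function.update w x f y (θ y) =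
        f (θ x) * ∏ y ∈ ℓ.vars.erase x, w y (θ y) := by
      rw [← Finset.mul_prod_erase _ _ hx, Function.update_self]
      congr 1
      refine Finset.prod_congr rfl fun y hy => ?_
      rw [Function.update_of_ne (Finset.ne_of_mem_erase hy)]
    simp only [matchWt_bind, key]
    ring
  · simp only [matchWt_eq_zero h, mul_zero, add_zero]

theorem matchWt_rename {ℓ : RTree rk X} {e : X → Y}
    (he : Function.Injective e) (w : Y → RTree rk Empty → ℕ) (t : RTree rk Empty) :
    (ℓ.bind fun x => var (e x)).matchWt w t = ℓ.matchWt (fun x => w (e x)) t := by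
  rw [matchWt_subst]
  · exact congrArg (fun f => ℓ.matchWt f t) (funext fun x => funext fun t => matchWt_var _ _ _)
  · intro x _ x' _ y hy hy'
    rw [vars_var, Finset.mem_singleton] at hy hy'
    exact he (hy.symm.trans hy')

theorem infinite_of_height_pos {t : RTree rk Empty} (ht : 0 < t.height) :
    (Set.univ : Set (RTree rk Empty)).Infinite := by
  obtain ⟨a, ha⟩ : ∃ a, 0 < rk a := by
    cases t with
    | var z => exact z.elim
    | node a ts =>
      refine ⟨a, Nat.pos_of_ne_zero fun h => ?_⟩
      have : IsEmpty (Fin (rk a)) := by rw [h]; infer_instance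
      simp [height] at ht
  intro hfin
  obtain ⟨s, -, hs⟩ := Set.exists_max_image Set.univ height hfin ⟨t, trivial⟩
  have h1 := hs (node a fun _ => s) trivial
  have h2 := Finset.le_sup (f := fun _ : Fin (rk a) => s.height + 1)
    (Finset.mem_univ ⟨0, ha⟩)
  rw [height] at h1
  omega

end RTree

namespace HomRule

open RTree

variable {A : Type u} {rk : A → ℕ} {Q Q' : Type v} {ι ι' : Type w}

/-- Rename the states of a rule. -/
def map (e : Q → Q') (r : HomRule rk Q) : HomRule rk Q' where
  lhs := r.lhs.bind fun x => var (x.1, e x.2)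
  target := e r.target
  wt := r.wt
  lhs_ne_var := mapPos_ne_var r.lhs_ne_var _

theorem matchWt_map {ℓ : RTree rk (List ℕ × Q)} {e : Q → Q'} (he : Function.Injective e)
    (w : Q' → RTree rk Empty → ℕ) (t : RTree rk Empty) :
    (ℓ.bind fun x => var (x.1, e x.2)).matchWt (fun x => w x.2) t =
      ℓ.matchWt (fun x => w (e x.2)) t :=
  matchWt_rename (e := fun x => (x.1, e x.2))
    (fun _ _ h => Prod.ext (Prod.mk.inj h).1 (he (Prod.mk.inj h).2)) _ t

variable [Fintype A] [Fintype ι] [Fintype ι']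

theorem value_ne_zero_iff {r : ι → HomRule rk Q} {q : Q} {t : RTree rk Empty} :
    value r q t ≠ 0 ↔ ∃ i, (r i).target = q ∧ (r i).wt ≠ 0 ∧
      (r i).lhs.matchWt (fun x => value r x.2) t ≠ 0 := by
  rw [isSolution_value r q t, ne_eq, Finset.sum_eq_zero_iff]
  simp

theorem value_bind_update_ne_zero [DecidableEq (List ℕ × Q)] {r : ι → HomRule rk Q} {i : ι}
    (hwt : (r i).wt ≠ 0) {θ : List ℕ × Q → RTree rk Empty}
    (hθ : ∀ x ∈ (r i).lhs.vars, value r x.2 (θ x) ≠ 0) {x : List ℕ × Q} {s : RTree rk Empty}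
    (hs : value r x.2 s ≠ 0) :
    value r (r i).target ((r i).lhs.bind (Function.update θ x s)) ≠ 0 := by
  refine value_ne_zero_iff.2 ⟨i, rfl, hwt, ?_⟩
  have := matchWt_bind_update_ne_zero (ℓ := (r i).lhs) (w := fun x => value r x.2) (θ := θ) hθ
    (x := x) (s := s) hs
  exact this

open Classical in
/-- If only finitely many trees have nonzero value at `q`, then their height is bounded in terms of
the number of states with this property. -/
theorem height_le_of_finite [Fintype Q] {r : ι → HomRule rk Q} {m : ℕ}
    (hm : ∀ i, (r i).lhs.height ≤ m) {q : Q} (hq : {t | value r q t ≠ 0}.Finite)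
    {t : RTree rk Empty} (ht : value r q t ≠ 0) :
    t.height ≤ m * (Finset.univ.filter fun q' => {t | value r q' t ≠ 0}.Finite).card := by
  -- Counting only finite states whose trees have height at most `n` makes the count drop at each
  -- descent.
  have key : ∀ n q, {t | value r q t ≠ 0}.Finite → ∀ t, value r q t ≠ 0 → t.height = n →
      (∀ s, value r q s ≠ 0 → s.height ≤ n) →
      n ≤ m * (Finset.univ.filter fun q' => {t | value r q' t ≠ 0}.Finite ∧
        ∀ s, value r q' s ≠ 0 → s.height ≤ n).card := by
    intro n
    induction n using Nat.strong_induction_on with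
    | _ n ih =>
      intro q hfin t ht htn hmax
      obtain ⟨i, rfl, hwt, hi⟩ := value_ne_zero_iff.1 ht
      obtain ⟨θ, rfl, hθ⟩ := exists_of_matchWt_ne_zero hi
      have hqmem : (r i).target ∈ Finset.univ.filter fun q' => {t | value r q' t ≠ 0}.Finite ∧
          ∀ s, value r q' s ≠ 0 → s.height ≤ n := by simpa using ⟨hfin, hmax⟩
      rcases height_bind_le (t := (r i).lhs) (θ := θ) with h | ⟨x, hx, h⟩
      · have := Finset.card_pos.2 ⟨_, hqmem⟩
        have h3 := hm i
        nlinarith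
      · have hup : ∀ s, value r x.2 s ≠ 0 →
            value r (r i).target ((r i).lhs.bind (Function.update θ x s)) ≠ 0 := fun s hs =>
          value_bind_update_ne_zero hwt hθ hs
        -- Exchanging the subtree at `x` embeds the trees of this state into the finite set of trees
        -- of the target.
        have hfin' : {t | value r x.2 t ≠ 0}.Finite := by
          refine Set.Finite.of_finite_image
            (f := fun s => (r i).lhs.bind (Function.update θ x s)) (hfin.subset ?_) ?_
          · rintro _ ⟨s, hs, rfl⟩
            exact hup s hs
          · intro s _ s' _ e
            simpa using eq_of_bind_eq e hx
        have hlt : ∀ s, value r x.2 s ≠ 0 → s.height < n := by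
          intro s hs
          have h1 := height_lt_height_bind (r i).lhs_ne_var (θ := Function.update θ x s) hx
          rw [Function.update_self] at h1
          exact h1.trans_le (hmax _ (hup s hs))
        obtain ⟨s, hs, hsmax⟩ := Set.exists_max_image _ height hfin' ⟨θ x, hθ x hx⟩
        have h1 := ih s.height (hlt s hs) x.2 hfin' s hs rfl hsmax
        -- The target state is lost at the lower bound, as it derives a tree of height `n`.
        have h2 : (Finset.univ.filter fun q' => {t | value r q' t ≠ 0}.Finite ∧
            ∀ s', value r q' s' ≠ 0 → s'.height ≤ s.height).card <
            (Finset.univ.filter fun q' => {t | value r q' t ≠ 0}.Finite ∧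
            ∀ s, value r q' s ≠ 0 → s.height ≤ n).card := by
          refine Finset.card_lt_card ⟨fun q' hq' => ?_, fun hsub => ?_⟩
          · simp only [Finset.mem_filter, Finset.mem_univ, true_and] at hq' ⊢
            exact ⟨hq'.1, fun s' hs' => (hq'.2 s' hs').trans (hlt s hs).le⟩
          · have := hsub hqmem
            simp only [Finset.mem_filter, Finset.mem_univ, true_and] at this
            have h4 := this.2 _ ht
            have h5 := hlt s hs
            omega
        have h3 := hsmax (θ x) (hθ x hx)
        have h4 := hm i
        have h5 := Nat.mul_le_mul_left m h2
        rw [Nat.mul_succ] at h5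
        omega
  obtain ⟨s, hs, hsmax⟩ := Set.exists_max_image _ height hq ⟨t, ht⟩
  refine (hsmax t ht).trans ((key _ q hq s hs rfl hsmax).trans (Nat.mul_le_mul_left m ?_))
  exact Finset.card_le_card (Finset.monotone_filter_right _ fun _ _ h => h.1)

/-- All rules for renamed states are renamed old rules, so the old recursion still holds and
uniqueness applies. -/
theorem value_map {r : ι → HomRule rk Q} {r' : ι' → HomRule rk Q'} {e : Q → Q'} {j : ι → ι'}
    (he : Function.Injective e) (hj : Function.Injective j) (h : ∀ i, r' (j i) = (r i).map e)
    (h' : ∀ k q, (r' k).target = e q → k ∈ Set.range j) (q : Q) :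
    value r' (e q) = value r q := by
  refine IsSolution.eq_value (f := fun q => value r' (e q)) (fun q t => ?_) q
  change value r' (e q) t = _
  rw [isSolution_value r' (e q) t]
  symm
  refine Fintype.sum_of_injective j hj _ _ (fun k hk => ?_) fun i => ?_
  · exact if_neg fun hk' => hk (h' k q hk')
  · rw [h]
    by_cases hq : (r i).target = q
    · rw [if_pos hq, if_pos (show ((r i).map e).target = e q from congrArg e hq)]
      exact congrArg _ (matchWt_map he (value r') t).symm
    · rw [if_neg hq, if_neg (show ¬ ((r i).map e).target = e q from fun h => hq (he h))]

/-- `g` is a linear combination of the functions computed by a finite family of rules. -/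
def Representable (g : RTree rk Empty → ℕ) : Prop :=
  ∃ (Q : Type v) (_ : Fintype Q) (ι : Type w) (_ : Fintype ι) (r : ι → HomRule rk Q) (F : Q → ℕ),
    ∀ t, g t = ∑ q, F q * value r q t

theorem Representable.add {g g' : RTree rk Empty → ℕ} (hg : Representable.{u, v, w} g)
    (hg' : Representable.{u, v, w} g') : Representable.{u, v, w} fun t => g t + g' t := by
  obtain ⟨Q, _, ι, _, r, F, h⟩ := hg
  obtain ⟨Q', _, ι', _, r', F', h'⟩ := hg'
  refine ⟨Q ⊕ Q', inferInstance, ι ⊕ ι', inferInstance,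
    Sum.elim (fun i => (r i).map Sum.inl) (fun i => (r' i).map Sum.inr), Sum.elim F F', fun t => ?_⟩
  change g t + g' t = _
  rw [Fintype.sum_sum_type, h, h']
  congr 1
  · refine Finset.sum_congr rfl fun q _ => ?_
    rw [value_map (r := r) (j := Sum.inl) Sum.inl_injective Sum.inl_injective (fun i => rfl)]
    · rfl
    · rintro (k | k) q hk
      · exact ⟨k, rfl⟩
      · cases hk
  · refine Finset.sum_congr rfl fun q _ => ?_
    rw [value_map (r := r') (j := Sum.inr) Sum.inr_injective Sum.inr_injective (fun i => rfl)]
    · rfl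
    · rintro (k | k) q hk
      · cases hk
      · exact ⟨k, rfl⟩

/-- Add a new state, together with a single rule for it. -/
def addRoot (r : ι → HomRule rk Q) (ℓ : RTree rk (List ℕ × Q)) (hℓ : ∀ x, ℓ ≠ var x) (c : ℕ) :
    Option ι → HomRule rk (Option Q)
  | some i => (r i).map some
  | none =>
    { lhs := ℓ.bind fun x => var (x.1, some x.2)
      target := none
      wt := c
      lhs_ne_var := mapPos_ne_var hℓ _ }

end HomRule

/-! ### Splitting a term off by expanding a variable -/

namespace HomRule

open RTree

variable {A : Type u} {rk : A → ℕ} {Q : Type v} {ι : Type w} [Fintype A] [Fintype ι]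

theorem value_addRoot_some (r : ι → HomRule rk Q) (ℓ : RTree rk (List ℕ × Q))
    (hℓ : ∀ x, ℓ ≠ var x) (c : ℕ) (q : Q) : value (addRoot r ℓ hℓ c) (some q) = value r q := by
  refine value_map (j := some) (Option.some_injective _) (Option.some_injective _)
    (fun i => rfl) ?_ q
  rintro (_ | i) q hq
  · cases hq
  · exact ⟨i, rfl⟩

theorem value_addRoot_none (r : ι → HomRule rk Q) (ℓ : RTree rk (List ℕ × Q))
    (hℓ : ∀ x, ℓ ≠ var x) (c : ℕ) (t : RTree rk Empty) :
    value (addRoot r ℓ hℓ c) none t = c * ℓ.matchWt (fun x => value r x.2) t := by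
  classical
  rw [isSolution_value (addRoot r ℓ hℓ c) none t, Fintype.sum_option, Finset.sum_eq_zero, add_zero]
  · rw [if_pos (show (addRoot r ℓ hℓ c none).target = none from rfl)]
    change c * (ℓ.bind fun x => var (x.1, some x.2)).matchWt _ t = _
    rw [matchWt_map (Option.some_injective _) (value (addRoot r ℓ hℓ c))]
    simp only [value_addRoot_some]
  · intro i _
    exact if_neg fun h => by cases h

/-- A proper term becomes the rule of a fresh state; a bare variable is not a legal left-hand side
and is expressed by the final weight instead. -/
theorem representable_matchWt [Fintype Q] (r : ι → HomRule rk Q) (ℓ : RTree rk (List ℕ × Q))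
    (c : ℕ) : Representable.{u, v, w} fun t => c * ℓ.matchWt (fun x => value r x.2) t := by
  classical
  by_cases hℓ : ∀ x, ℓ ≠ var x
  · refine ⟨Option Q, inferInstance, Option ι, inferInstance, addRoot r ℓ hℓ c,
      fun o => o.elim 1 fun _ => 0, fun t => ?_⟩
    simp [Fintype.sum_option, value_addRoot_none]
  · push Not at hℓ
    obtain ⟨x, rfl⟩ := hℓ
    exact ⟨Q, inferInstance, ι, inferInstance, r, fun q => if q = x.2 then c else 0,
      fun t => by simp⟩

open Classical in
/-- The value at `q` when the rule `j` is not used at the root. -/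
noncomputable def valueWithout (r : ι → HomRule rk Q) (j : ι) (q : Q) (t : RTree rk Empty) : ℕ :=
  ∑ i, if (r i).target = q ∧ i ≠ j then
    (r i).wt * (r i).lhs.matchWt (fun x => value r x.2) t else 0

theorem value_eq_add_valueWithout (r : ι → HomRule rk Q) (j : ι) (t : RTree rk Empty) :
    value r (r j).target t = (r j).wt * (r j).lhs.matchWt (fun x => value r x.2) t +
      valueWithout r j (r j).target t := by
  classical
  rw [isSolution_value r _ t, valueWithout, ← Finset.add_sum_erase _ _ (Finset.mem_univ j),
    if_pos rfl, ← Finset.add_sum_erase _ (fun i => ite _ _ _) (Finset.mem_univ j),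
    if_neg (fun h => h.2 rfl), zero_add]
  congr 1
  refine Finset.sum_congr rfl fun i hi => ?_
  have hij := Finset.ne_of_mem_erase hi
  simp [hij]

open Classical in
/-- Add a copy of the state `q` for which the rule `j` is not available. -/
noncomputable def addWithout (r : ι → HomRule rk Q) (j : ι) (q : Q) :
    ι ⊕ ι → HomRule rk (Option Q)
  | .inl i => (r i).map some
  | .inr i => { (r i).map some with
      target := none
      wt := if (r i).target = q ∧ i ≠ j then (r i).wt else 0 }

theorem value_addWithout_some (r : ι → HomRule rk Q) (j : ι) (q q' : Q) :
    value (addWithout r j q) (some q') = value r q' := by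
  refine value_map (j := Sum.inl) (Option.some_injective _) Sum.inl_injective
    (fun i => rfl) ?_ q'
  rintro (i | i) q hq
  · exact ⟨i, rfl⟩
  · cases hq

theorem value_addWithout_none (r : ι → HomRule rk Q) (j : ι) (q : Q) :
    value (addWithout r j q) none = valueWithout r j q := by
  classical
  funext t
  rw [isSolution_value (addWithout r j q) none t, Fintype.sum_sum_type, Finset.sum_eq_zero,
    zero_add, valueWithout]
  · refine Finset.sum_congr rfl fun i _ => ?_
    rw [if_pos (show (addWithout r j q (Sum.inr i)).target = none from rfl)]
    change (if (r i).target = q ∧ i ≠ j then (r i).wt else 0) *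
      ((r i).lhs.bind fun x => var (x.1, some x.2)).matchWt _ t = _
    rw [matchWt_map (Option.some_injective _) (value (addWithout r j q))]
    simp only [value_addWithout_some]
    split_ifs <;> simp
  · intro i _
    exact if_neg fun h => by cases h

open Classical in
theorem representable_valueWithout [Fintype Q] (r : ι → HomRule rk Q)
    (ℓ : RTree rk (List ℕ × Q)) (c : ℕ) (x : List ℕ × Q) (j : ι) :
    Representable.{u, v, w} fun t => c * ℓ.matchWt
      (Function.update (fun y : List ℕ × Q => value r y.2) x (valueWithout r j x.2)) t := by
  -- Only `x` is moved to the copied state `none` lacking rule `j`; other variables of the same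
  -- state keep the original one.
  let e : List ℕ × Q → List ℕ × Option Q := fun y => (y.1, if y = x then none else some y.2)
  have he : Function.Injective e := by
    rintro ⟨y, q⟩ ⟨y', q'⟩ h
    simp only [e, Prod.mk.injEq] at h
    obtain ⟨rfl, h⟩ := h
    split_ifs at h with h1 h2
    · rw [h1, h2]
    · rw [Option.some.inj h]
  have := representable_matchWt (addWithout r j x.2) (ℓ.bind fun y => var (e y)) c
  simp only [matchWt_rename he] at this
  convert this using 4 with t
  funext y
  by_cases hy : y = x
  · subst hy
    simp only [Function.update_self, e, if_true, value_addWithout_none]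
  · simp only [Function.update_of_ne hy, e, if_neg hy, value_addWithout_some]

open Classical in
/-- Replace the variable `x` by a copy of `m` with fresh variables. -/
noncomputable def graft (ℓ : RTree rk (List ℕ × Q)) (x : List ℕ × Q) (m : RTree rk (List ℕ × Q)) :
    RTree rk (List ℕ × Q) :=
  ℓ.bind fun y => if y = x then m.bind fun z => var (1 :: z.1, z.2) else var (0 :: y.1, y.2)

-- The tags 0 and 1 keep old and grafted variables apart. All occurrences of `x` receive the same
-- copy, which preserves the equality it imposed.
open Classical in
omit [Fintype A] in
theorem matchWt_graft (ℓ : RTree rk (List ℕ × Q)) (x : List ℕ × Q) (m : RTree rk (List ℕ × Q))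
    (w : Q → RTree rk Empty → ℕ) (t : RTree rk Empty) :
    (graft ℓ x m).matchWt (fun y => w y.2) t =
      ℓ.matchWt (Function.update (fun y => w y.2) x (m.matchWt fun y => w y.2)) t := by
  rw [graft, matchWt_subst]
  · congr 1
    funext y t
    by_cases hy : y = x
    · subst hy
      rw [if_pos rfl, Function.update_self,
        matchWt_rename (e := fun z : List ℕ × Q => (1 :: z.1, z.2))]
      rintro ⟨a, b⟩ ⟨c, d⟩ h
      simpa using h
    · rw [if_neg hy, Function.update_of_ne hy, matchWt_var]
  · intro y _ y' _ z hz hz'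
    split_ifs at hz hz' with h h' h'
    · rw [h, h']
    · obtain ⟨_, -, h1⟩ := mem_vars_bind.1 hz
      simp only [vars_var, Finset.mem_singleton] at h1 hz'
      rw [h1] at hz'
      simp at hz'
    · obtain ⟨_, -, h1⟩ := mem_vars_bind.1 hz'
      simp only [vars_var, Finset.mem_singleton] at h1 hz
      rw [h1] at hz
      simp at hz
    · simp only [vars_var, Finset.mem_singleton] at hz hz'
      rw [hz] at hz'
      simp only [Prod.mk.injEq, List.cons.injEq, true_and] at hz'
      exact Prod.ext hz'.1 hz'.2

omit [Fintype A] in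
theorem graft_ne_var {ℓ : RTree rk (List ℕ × Q)} {x : List ℕ × Q} {m : RTree rk (List ℕ × Q)}
    (hm : ∀ z, m ≠ var z) (hx : x ∈ ℓ.vars) (z : List ℕ × Q) : graft ℓ x m ≠ var z := by
  cases ℓ with
  | var y =>
    simp only [vars_var, Finset.mem_singleton] at hx
    subst hx
    rw [graft, bind_var, if_pos rfl]
    exact mapPos_ne_var hm _ z
  | node a ts => exact fun h => by cases h

omit [Fintype A] in
theorem mem_leaves_graft {ℓ : RTree rk (List ℕ × Q)} {x : List ℕ × Q}
    {m : RTree rk (List ℕ × Q)} {w u : List ℕ} {y : List ℕ × Q} (hw : (w, x) ∈ ℓ.leaves)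
    (hu : (u, y) ∈ m.leaves) : (w ++ u, (1 :: y.1, y.2)) ∈ (graft ℓ x m).leaves := by
  refine mem_leaves_bind hw ?_
  rw [if_pos rfl]
  have := mem_leaves_bind (σ := fun z : List ℕ × Q => (var (1 :: z.1, z.2) : RTree rk _)) hu
    (x := []) (y := (1 :: y.1, y.2)) (by simp [leaves])
  simpa using this

/-- The value at the state of `x` is the contribution of rule `j` plus that of the other rules;
linearity in `x` distributes the term accordingly. -/
theorem exists_graft [Fintype Q] {r : ι → HomRule rk Q} {ℓ : RTree rk (List ℕ × Q)} (c : ℕ)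
    {x : List ℕ × Q} (hx : x ∈ ℓ.vars)
    (hM : ∃ t, ℓ.matchWt (fun y => value r y.2) t ≠ 0) {j : ι} (hj : (r j).target = x.2)
    {s : RTree rk Empty} (hs : (r j).lhs.matchWt (fun y => value r y.2) s ≠ 0) :
    (∃ t, (graft ℓ x (r j).lhs).matchWt (fun y => value r y.2) t ≠ 0) ∧
    ∃ g, Representable.{u, v, w} g ∧ ∀ t, c * ℓ.matchWt (fun y => value r y.2) t =
      c * (r j).wt * (graft ℓ x (r j).lhs).matchWt (fun y => value r y.2) t + g t := by
  classical
  constructor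
  · obtain ⟨t, ht⟩ := hM
    obtain ⟨θ, rfl, hθ⟩ := exists_of_matchWt_ne_zero ht
    refine ⟨ℓ.bind (Function.update θ x s), ?_⟩
    rw [matchWt_graft]
    refine matchWt_bind_ne_zero fun y hy => ?_
    by_cases hyx : y = x
    · subst hyx; simpa using hs
    · simpa [hyx] using hθ y hy
  · refine ⟨_, representable_valueWithout r ℓ c x j, fun t => ?_⟩
    have h := matchWt_update_add hx (fun y : List ℕ × Q => value r y.2) (r j).wt
      ((r j).lhs.matchWt fun y => value r y.2) (valueWithout r j x.2) t
    rw [matchWt_graft, mul_assoc, ← mul_add, ← h]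
    congr 2
    rw [eq_comm, Function.update_eq_self_iff]
    funext s
    rw [← hj, value_eq_add_valueWithout]

/-- If the rule `i`, in which the variable `y` is repeated, occurs below the variable `x` of `ℓ`,
then a term with a repeated variable of the same state can be split off. -/
theorem Occurs.split [Fintype Q] {r : ι → HomRule rk Q} {i : ι} {q : Q} (h : Occurs r i q)
    {y : List ℕ × Q} {u v : List ℕ} (hne : u ≠ v) (hu : (u, y) ∈ (r i).lhs.leaves)
    (hv : (v, y) ∈ (r i).lhs.leaves) {ℓ : RTree rk (List ℕ × Q)} {c : ℕ} (hc : c ≠ 0)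
    {x : List ℕ × Q} (hx : x ∈ ℓ.vars) (hxq : x.2 = q)
    (hM : ∃ t, ℓ.matchWt (fun y => value r y.2) t ≠ 0) :
    ∃ (ℓ' : RTree rk (List ℕ × Q)) (c' : ℕ) (y' : List ℕ × Q) (u' v' : List ℕ)
      (g : RTree rk Empty → ℕ), c' ≠ 0 ∧ (∀ z, ℓ' ≠ var z) ∧ u' ≠ v' ∧ (u', y') ∈ ℓ'.leaves ∧
      (v', y') ∈ ℓ'.leaves ∧ y'.2 = y.2 ∧ (∃ t, ℓ'.matchWt (fun y => value r y.2) t ≠ 0) ∧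
      Representable.{u, v, w} g ∧ ∀ t, c * ℓ.matchWt (fun y => value r y.2) t =
        c' * ℓ'.matchWt (fun y => value r y.2) t + g t := by
  induction h generalizing ℓ c x with
  | root s hwt hs =>
    obtain ⟨hM', g, hg, hgt⟩ := exists_graft c hx hM hxq.symm hs
    obtain ⟨w, hw⟩ := mem_vars.1 hx
    exact ⟨_, _, _, _, _, g, mul_ne_zero hc hwt, graft_ne_var (r i).lhs_ne_var hx,
      fun e => hne (List.append_cancel_left e), mem_leaves_graft hw hu, mem_leaves_graft hw hv, rfl,
      hM', hg, hgt⟩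
  | step j s z hwt hs hz _ ih =>
    obtain ⟨hM', g, hg, hgt⟩ := exists_graft c hx hM hxq.symm hs
    obtain ⟨w, hw⟩ := mem_vars.1 hx
    obtain ⟨w', hw'⟩ := mem_vars.1 hz
    obtain ⟨ℓ', c', y', u', v', g', h1, h2, h3, h4, h5, h6, h7, h8, h9⟩ :=
      ih (mul_ne_zero hc hwt) (mem_vars.2 ⟨_, mem_leaves_graft hw hw'⟩) rfl hM'
    exact ⟨ℓ', c', y', u', v', _, h1, h2, h3, h4, h5, h6, h7, h8.add hg, fun t => by
      rw [hgt, h9, add_assoc]⟩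

end HomRule

/-! ### The grammar with a single root rule, and the decomposition -/

namespace HomRule

open RTree

variable {A : Type u} {rk : A → ℕ} {Q : Type v} {ι : Type w} [Fintype A] [Fintype ι]

/-- The trimmed grammar with the single root rule `ℓ` has a repeated root constraint whose state
generates all trees with nonzero value. -/
theorem exists_root_grammar [Fintype Q] (r : ι → HomRule rk Q) {ℓ : RTree rk (List ℕ × Q)}
    (hℓ : ∀ x, ℓ ≠ var x) {c : ℕ} (hc : c ≠ 0) {y : List ℕ × Q} {u v : List ℕ} (huv : u ≠ v)
    (hu : (u, y) ∈ ℓ.leaves) (hv : (v, y) ∈ ℓ.leaves)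
    (hM : ∃ t, ℓ.matchWt (fun y => value r y.2) t ≠ 0) :
    ∃ G : WTGc rk (Option (Option Q)), G.IsWTGh ∧ G.IsTrim ∧
      (∀ t, G.sem t = c * ℓ.matchWt (fun y => value r y.2) t) ∧
      G.F (some none) ≠ 0 ∧ (∀ q, q ≠ none → G.F (some q) = 0) ∧
      ∃ pf ∈ G.P, pf.target = some none ∧ (∀ p ∈ G.P, p.target = some none → p = pf) ∧
        ∃ u v, (u, v) ∈ pf.constraints ∧
          pf.lhs.subtree? u = some (var (some (some y.2))) ∧
          pf.lhs.subtree? v = some (var none) ∧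
          ∀ s, value r y.2 s ≠ 0 → (G.derivations (some (some y.2)) s).Nonempty := by
  classical
  -- In the resulting grammar `none` is the sink, `some none` the new root state, and `some (some
  -- q)` an old state.
  set r' := addRoot r ℓ hℓ c with hr'
  let F : Option Q → ℕ := fun o => o.elim 1 fun _ => 0
  let G := (toWTGc r' F).trim
  have hsem (t : RTree rk Empty) : G.sem t = c * ℓ.matchWt (fun y => value r y.2) t := by
    rw [WTGc.sem_trim, sem_toWTGc, Fintype.sum_option]
    simp [F, hr', value_addRoot_none]
  have huniq : ∀ p ∈ G.P, p.target = some none → p = (r' none).toProduction := by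
    intro p hp hpt
    rcases mem_toWTGc.1 (WTGc.trim_subset _ hp) with ⟨a, rfl⟩ | ⟨i, rfl⟩
    · cases hpt
    · cases i with
      | none => rfl
      | some i => cases hpt
  -- Trimming keeps the semantics, so nonzero weight at `t` shows that the root production survives
  -- and still derives `t`.
  have hroot (t : RTree rk Empty) (ht : ℓ.matchWt (fun y => value r y.2) t ≠ 0) :
      (r' none).toProduction ∈ G.P ∧ G.weight (r' none).toProduction.lhs t ≠ 0 := by
    have h := mul_ne_zero hc ht
    rw [← hsem, WTGc.sem_eq] at h
    obtain ⟨q, -, hq⟩ := Finset.exists_ne_zero_of_sum_ne_zero h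
    obtain rfl : q = some none := by
      rcases q with _ | _ | q
      · exact absurd rfl (left_ne_zero_of_mul hq)
      · rfl
      · exact absurd rfl (left_ne_zero_of_mul hq)
    have hq := right_ne_zero_of_mul hq
    rw [WTGc.weight_var] at hq
    obtain ⟨p, hp, hpne⟩ := Finset.exists_ne_zero_of_sum_ne_zero hq
    split_ifs at hpne with hcond
    · rw [← huniq p hp hcond.1]
      exact ⟨hp, right_ne_zero_of_mul hpne⟩
    · exact absurd rfl hpne
  obtain ⟨t, ht⟩ := hM
  have hlv {w : List ℕ} {z : List ℕ × Q} (hw : (w, z) ∈ ℓ.leaves) :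
      (w, (z.1, some z.2)) ∈ (r' none).lhs.leaves :=
    leaves_mapPos_iff.2 ⟨z, hw, rfl⟩
  obtain ⟨a, ha, hmin⟩ := exists_least_leaf (mem_vars.2 ⟨u, hlv hu⟩)
  obtain ⟨b, hb, hab⟩ : ∃ b, (b, (y.1, some y.2)) ∈ (r' none).lhs.leaves ∧ b ≠ a := by
    by_cases h : u = a
    · exact ⟨v, hlv hv, fun e => huv (h.trans e.symm)⟩
    · exact ⟨u, hlv hu, h⟩
  have hlt : PosLT a b := by
    rcases posLT_trichotomy a b with h | h | h
    · exact h
    · exact absurd h.symm hab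
    · exact absurd h (hmin b hb)
  have hsuba : (r' none).toProduction.lhs.subtree? a = some (var (some (some y.2))) := by
    rw [subtree?_toProduction ha, if_neg]
    rintro ⟨b, h, h'⟩
    exact hmin b h' h
  refine ⟨G, (isWTGh_toWTGc r' F).trim, WTGc.isTrim_trim _, hsem, one_ne_zero, ?_,
    (r' none).toProduction, (hroot t ht).1, rfl, huniq, a, b, mem_constraints.2 ⟨_, ha, hb⟩, hsuba,
    ?_, fun s hs => ?_⟩
  · rintro (_ | q) hq
    · exact absurd rfl hq
    · rfl
  · rw [subtree?_toProduction hb, if_pos ⟨a, hlt, ha⟩]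
  · obtain ⟨θ, rfl, hθ⟩ := exists_of_matchWt_ne_zero ht
    -- Putting `s` for `y` in a matched tree keeps the weight nonzero, and the factor at the guard
    -- `a` then gives a derivation of `s` within the trimmed grammar.
    have hs' := matchWt_bind_update_ne_zero (ℓ := ℓ) (w := fun y : List ℕ × Q => value r y.2)
      (θ := θ) hθ (x := y) (s := s) hs
    have hne := (hroot _ hs').2
    obtain ⟨ρ, hρ⟩ := WTGc.exists_eq_bindPos_of_weight_ne_zero hne
    rw [hρ, WTGc.weight_bindPos, Finset.prod_ne_zero_iff] at hne
    have h1 := hne _ (mem_leaves.2 hsuba)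
    have haℓ : (a, y) ∈ ℓ.leaves := by
      obtain ⟨⟨z, q⟩, hz, e⟩ := leaves_mapPos_iff.1 ha
      simp only [Prod.mk.injEq, Option.some.injEq] at e
      rwa [show (z, q) = y from Prod.ext e.1 e.2] at hz
    have h2 := subtree?_bindPos hsuba ρ
    rw [← hρ, RTree.bind, subtree?_bindPos (mem_leaves.1 haℓ), Function.update_self,
      Option.some.injEq] at h2
    simp only [← h2] at h1
    obtain ⟨d, hd, -⟩ := WTGc.weight_ne_zero_iff.1 h1
    exact ⟨d, hd⟩

end HomRule

open RTree in
theorem WTGc.IsWTGh.infinite_of_height_lt {A : Type u} [Fintype A] {rk : A → ℕ} {Q : Type v}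
    [Fintype Q] {G : WTGc rk (Option Q)} (hG : G.IsWTGh) (htrim : G.IsTrim) {q : Option Q}
    {t : RTree rk Empty} (ht : G.height < t.height) (hd : (G.derivations q t).Nonempty) :
    {s | HomRule.value G.toHomRule q s ≠ 0}.Infinite := by
  classical
  intro hfin
  have hval : HomRule.value G.toHomRule q t ≠ 0 := by
    rw [← hG.weight_var_eq_value, weight_ne_zero_iff]
    obtain ⟨d, hd⟩ := hd
    exact ⟨d, hd, htrim.derivWt_ne_zero hG hd⟩
  have hle := HomRule.height_le_of_finite (m := G.heightP) (fun p => ?_) hfin hval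
  · have hsub : (Finset.univ.filter fun q' : Option Q =>
        {t | HomRule.value G.toHomRule q' t ≠ 0}.Finite) ⊆ Finset.univ.erase none := by
      intro q' hq'
      rw [Finset.mem_erase]
      refine ⟨?_, Finset.mem_univ _⟩
      rintro rfl
      -- The sink derives all trees, of which there are infinitely many since `t` has positive
      -- height. So it is not among the counted states, and the bound uses |Q| rather than |Q| + 1.
      refine infinite_of_height_pos (Nat.zero_lt_of_lt ht)
        ((Finset.mem_filter.1 hq').2.subset fun s _ => ?_)
      change HomRule.value G.toHomRule none s ≠ 0
      rw [← hG.weight_var_eq_value, hG.weight_sink]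
      exact one_ne_zero
    have hcard := Finset.card_le_card hsub
    rw [Finset.card_erase_of_mem (Finset.mem_univ _), Finset.card_univ, Fintype.card_option,
      Nat.add_sub_cancel] at hcard
    have := Nat.mul_le_mul_left G.heightP hcard
    rw [WTGc.height, mul_comm] at ht
    omega
  · rw [show (G.toHomRule p).lhs.height = p.1.lhs.height from height_mapPos _ _]
    exact Finset.le_sup (f := fun p : Production rk (Option Q) => p.lhs.height) p.2

theorem mainTheorem5 {A : Type u} [Fintype A] (rk : A → ℕ) {Q : Type v} [Fintype Q]
    (G : WTGc rk (Option Q)) (hG : G.IsWTGh) (htrim : G.IsTrim) (hdup : G.LargeDuplication) :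
    ∃ (Q₁ Q₂ : Type v) (_ : Fintype Q₁) (_ : Fintype Q₂)
      (G₁ : WTGc rk (Option Q₁)) (G₂ : WTGc rk (Option Q₂)),
      G₁.IsWTGh ∧ G₁.IsTrim ∧ G₂.IsWTGh ∧ G₂.IsTrim ∧
      (∀ t : RTree rk Empty, G.sem t = G₁.sem t + G₂.sem t) ∧
      ∃ f : Q₁, G₁.F (some f) ≠ 0 ∧ (∀ q : Q₁, q ≠ f → G₁.F (some q) = 0) ∧
        ∃ pf ∈ G₁.P, pf.target = some f ∧ (∀ p ∈ G₁.P, p.target = some f → p = pf) ∧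
          ∃ u v, (u, v) ∈ pf.constraints ∧ ∃ q : Option Q₁, q ≠ none ∧
            pf.lhs.subtree? u = some (RTree.var q) ∧
            pf.lhs.subtree? v = some (RTree.var none) ∧
            ∃ t : ℕ → RTree rk Empty, Function.Injective t ∧
              ∀ i, (G₁.derivations q (t i)).Nonempty := by
  classical
  obtain ⟨p, hp, u, v, huv, q, hq, hu, hv, t, ht, hd⟩ := hdup
  obtain ⟨q, rfl⟩ := Option.ne_none_iff_exists'.1 hq
  have hinf := hG.infinite_of_height_lt htrim ht hd
  rw [← RTree.mem_leaves] at hu hv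
  have hpt : p.target ≠ none := by
    intro h
    obtain ⟨a, rfl⟩ := hG.eq_sink p hp h
    simp [WTGc.sinkProduction] at huv
  obtain ⟨t₀, q₀, d, hd₀, hne, w, hw⟩ := htrim p hp hpt
  have hne' := right_ne_zero_of_mul hne
  obtain ⟨-, hocc⟩ := hG.occurs_of_mem hd₀ hne' hw hp hpt
  have hu' : (u, (u, some q)) ∈ (G.toHomRule ⟨p, hp⟩).lhs.leaves :=
    RTree.leaves_mapPos_iff.2 ⟨_, hu, WTGc.guardVar_some p u q⟩
  have hv' : (v, (u, some q)) ∈ (G.toHomRule ⟨p, hp⟩).lhs.leaves := by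
    refine RTree.leaves_mapPos_iff.2 ⟨_, hv, ?_⟩
    obtain ⟨a, q', ha, hq', e⟩ :=
      hG.guardVar_of_mem hp (hG.refl p hp v u (hG.symm p hp u v huv)) hv
    obtain rfl := hG.guard_unique hp (hG.trans p hp u v a huv (hG.symm p hp a v ha)) hu hq'
    change WTGc.guardVar p v none = _
    rw [e, RTree.leaf_unique hq' hu]
  have huv' : u ≠ v := by
    rintro rfl
    cases RTree.leaf_unique hu hv
  -- Unfolding starts from a single variable of state `q₀` with coefficient F(q₀).
  obtain ⟨ℓ, c, y, a, b, g, hc, hℓ, hab, ha, hb, hy, hM, hg, hsplit⟩ :=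
    hocc.split huv' hu' hv' (ℓ := RTree.var ([], q₀)) (left_ne_zero_of_mul hne)
      (x := ([], q₀)) (by simp) rfl ⟨t₀, by
        rw [RTree.matchWt_var, ← hG.weight_var_eq_value, WTGc.weight_ne_zero_iff]
        exact ⟨d, hd₀, hne'⟩⟩
  obtain ⟨G₁, h1, h2, h3, h4, h5, pf, hpf, h6, h7, a', b', h8, h9, h10, h11⟩ :=
    HomRule.exists_root_grammar G.toHomRule hℓ hc hab ha hb hM
  -- Only the final state `q₀` was unfolded; the others contribute to the second grammar unchanged.
  have hrest : HomRule.Representable fun t => ∑ q, (if q = q₀ then 0 else G.F q) *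
      HomRule.value G.toHomRule q t :=
    ⟨Option Q, inferInstance, _, inferInstance, G.toHomRule, _, fun t => rfl⟩
  obtain ⟨Q₂, _, ι, _, r, F, hr⟩ := hg.add hrest
  change y.2 = some q at hy
  rw [← hy] at hinf
  refine ⟨Option (Option Q), Q₂, inferInstance, inferInstance, G₁, (HomRule.toWTGc r F).trim, h1,
    h2, (HomRule.isWTGh_toWTGc r F).trim, WTGc.isTrim_trim _, fun t => ?_, none, h4, h5, pf, hpf,
    h6, h7, a', b', h8, _, Option.some_ne_none _, h9, h10, fun n => hinf.natEmbedding _ n, ?_,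
    fun n => h11 _ (hinf.natEmbedding _ n).2⟩
  · rw [WTGc.sem_trim, HomRule.sem_toWTGc, ← hr, h3, ← add_assoc, ← hsplit, RTree.matchWt_var,
      WTGc.sem_eq, ← Finset.add_sum_erase _ _ (Finset.mem_univ q₀),
      ← Finset.add_sum_erase _ (fun q => (if q = q₀ then 0 else G.F q) * _) (Finset.mem_univ q₀),
      if_pos rfl, zero_mul, zero_add, hG.weight_var_eq_value]
    congr 1
    refine Finset.sum_congr rfl fun q hq => ?_
    rw [if_neg (Finset.ne_of_mem_erase hq), hG.weight_var_eq_value]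
  · exact Subtype.val_injective.comp (hinf.natEmbedding _).injective
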